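/- Let $n\ge 1$ and let $W_n=\mathrm{Der}(\mathbb C[t_1,\dots,t_n])$ be the Lie algebra of polynomial vector fields, with enveloping algebra $U=U(W_n)$; put $\partial_i=\partial/\partial t_i$ and $h_i=t_i\partial_i$ for $i=1,\dots,n$. The monomials $\partial_1^{i_1}\cdots\partial_n^{i_n}$ ($i_1,\dots,i_n\ge 0$) form an Ore subset of $U$; let $U_\partial$ be the localization of $U$ at this set, let $U(\Delta_n)_\partial\subseteq U_\partial$ be the subalgebra generated by $\partial_1^{\pm1},\dots,\partial_n^{\pm1}$, and let $$H_n=\{u\in U_\partial\mid [u,\partial_i]=[u,h_i]=0,\ i=1,\dots,n\}.$$ Let $\Omega_{\mathbf 1}$ be the full subcategory of the category of $W_n$-modules consisting of the modules $M$ such that every $\partial_i-1$ acts locally nilpotently on $M$ and the space $\mathrm{wh}_{\mathbf 1}(M)=\{v\in M\mid \partial_i v=v,\ i=1,\dots,n\}$ is finite dimensional. On such $M$ the $\partial_i$ act invertibly, so $M$ is a $U_\partial$-module, and $H_n$ preserves $\mathrm{wh}_{\mathbf 1}(M)$. Then $\Omega_{\mathbf 1}$ is equivalent to the category of finite-dimensional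 $H_n$-modules. More precisely, for every finite-dimensional $H_n$-module $V$, made into an $H_nU(\Delta_n)_\partial$-module by $\partial_i v=v$ ($v\in V$, $i=1,\dots,n$), the module $U_\partial\otimes_{H_nU(\Delta_n)_\partial}V$, restricted to $W_n$, lies in $\Omega_{\mathbf 1}$; and the functors $$M\mapsto \mathrm{wh}_{\mathbf 1}(M),\qquad V\mapsto U_\partial\otimes_{H_nU(\Delta_n)_\partial}V$$ are mutually quasi-inverse equivalences between $\Omega_{\mathbf 1}$ and the category of finite-dimensional $H_n$-modules. -/

import Mathlib

open CategoryTheory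
universe v

noncomputable section
namespace WittWhittaker
open scoped TensorProduct

attribute [local instance] LieRing.ofAssociativeRing

/-- The Witt algebra `W_n = Der(ℂ[t₁,…,tₙ])`: the Lie algebra of polynomial vector fields,
with the commutator bracket. -/
abbrev Witt (n : ℕ) : Type :=
  Derivation ℂ (MvPolynomial (Fin n) ℂ) (MvPolynomial (Fin n) ℂ)

/-- The universal enveloping algebra `U = U(W_n)`. -/
abbrev UW (n : ℕ) : Type := UniversalEnvelopingAlgebra ℂ (Witt n)

/-- `∂ᵢ = ∂/∂tᵢ`, as an element of `U(W_n)`. -/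
def del {n : ℕ} (i : Fin n) : UW n :=
  UniversalEnvelopingAlgebra.ι ℂ (MvPolynomial.pderiv i : Witt n)

/-- `hᵢ = tᵢ ∂ᵢ`, as an element of `U(W_n)`. -/
def car {n : ℕ} (i : Fin n) : UW n :=
  UniversalEnvelopingAlgebra.ι ℂ
    ((MvPolynomial.X i : MvPolynomial (Fin n) ℂ) • (MvPolynomial.pderiv i : Witt n))

/-- The multiplicative set of the monomials `∂₁^{i₁} ⋯ ∂ₙ^{iₙ}` (the `∂ᵢ` commute, so this is
the submonoid that they generate). -/
def delSubmonoid (n : ℕ) : Submonoid (UW n) := Submonoid.closure (Set.range del)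

theorem iterate_eq_zero_mono {A : Type*} [Ring A] (D : A →+ A) {k l : ℕ} (hkl : k ≤ l) {a : A}
    (h : D^[k] a = 0) : D^[l] a = 0 := by
  obtain ⟨m, rfl⟩ := Nat.exists_eq_add_of_le hkl
  rw [add_comm, Function.iterate_add_apply, h, iterate_map_zero]

theorem locNil_add {A : Type*} [Ring A] (D : A →+ A) {a b : A}
    (ha : ∃ k, D^[k] a = 0) (hb : ∃ k, D^[k] b = 0) : ∃ k, D^[k] (a + b) = 0 := by
  obtain ⟨k, hk⟩ := ha
  obtain ⟨l, hl⟩ := hb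
  refine ⟨max k l, ?_⟩
  rw [iterate_map_add, iterate_eq_zero_mono D (le_max_left k l) hk,
    iterate_eq_zero_mono D (le_max_right k l) hl, add_zero]

theorem locNil_mul_aux {A : Type*} [Ring A] (D : A →+ A)
    (hD : ∀ a b, D (a * b) = D a * b + a * D b) (N : ℕ) :
    ∀ (k l : ℕ) (a b : A), k + l ≤ N → D^[k] a = 0 → D^[l] b = 0 → ∃ m, D^[m] (a * b) = 0 := by
  induction N with
  | zero =>
    intro k l a b hkl ha _
    obtain rfl : k = 0 := by omega
    exact ⟨0, by simp at ha; simp [ha]⟩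
  | succ N ih =>
    intro k l a b hkl ha hb
    rcases k with _ | k
    · exact ⟨0, by simp at ha; simp [ha]⟩
    rcases l with _ | l
    · exact ⟨0, by simp at hb; simp [hb]⟩
    obtain ⟨m, hm⟩ := locNil_add D (ih k (l + 1) (D a) b (by omega) ha hb)
      (ih (k + 1) l a (D b) (by omega) ha hb)
    exact ⟨m + 1, by rw [Function.iterate_succ_apply, hD, hm]⟩

theorem locNil_mul {A : Type*} [Ring A] (D : A →+ A)
    (hD : ∀ a b, D (a * b) = D a * b + a * D b) {a b : A}
    (ha : ∃ k, D^[k] a = 0) (hb : ∃ k, D^[k] b = 0) : ∃ k, D^[k] (a * b) = 0 := by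
  obtain ⟨k, hk⟩ := ha
  obtain ⟨l, hl⟩ := hb
  exact locNil_mul_aux D hD (k + l) k l a b le_rfl hk hl

theorem pderiv_locNil {n : ℕ} (i : Fin n) (p : MvPolynomial (Fin n) ℂ) :
    ∃ k, (MvPolynomial.pderiv i)^[k] p = 0 := by
  let D : MvPolynomial (Fin n) ℂ →+ MvPolynomial (Fin n) ℂ :=
    (MvPolynomial.pderiv i).toLinearMap.toAddMonoidHom
  change ∃ k, D^[k] p = 0
  induction p using MvPolynomial.induction_on with
  | C a => exact ⟨1, by simp [D]⟩
  | add p q hp hq => exact locNil_add D hp hq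
  | mul_X p j hp =>
    refine locNil_mul D (fun a b => ?_) hp ⟨2, ?_⟩
    · simp [D, Derivation.leibniz, mul_comm, add_comm]
    · by_cases h : j = i
      · subst h; simp [D]
      · simp [D, MvPolynomial.pderiv_X, h]

/-- Commutator with `s`. -/
def adHom {A : Type*} [Ring A] (s : A) : A →+ A :=
  AddMonoidHom.mulLeft s - AddMonoidHom.mulRight s

theorem adHom_apply {A : Type*} [Ring A] (s a : A) : adHom s a = s * a - a * s := rfl

theorem adHom_mul {A : Type*} [Ring A] (s a b : A) :
    adHom s (a * b) = adHom s a * b + a * adHom s b := by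
  simp only [adHom_apply]; noncomm_ring

theorem witt_locNil {n : ℕ} (i : Fin n) (w : Witt n) :
    ∃ k, (fun x : Witt n => ⁅(MvPolynomial.pderiv i : Witt n), x⁆)^[k] w = 0 := by
  have key : ∀ (k : ℕ) (w : Witt n) (j : Fin n),
      ((fun x : Witt n => ⁅(MvPolynomial.pderiv i : Witt n), x⁆)^[k] w) (MvPolynomial.X j) =
        (MvPolynomial.pderiv i)^[k] (w (MvPolynomial.X j)) := by
    intro k
    induction k with
    | zero => intro w j; rfl
    | succ k ih =>
      intro w j
      rw [Function.iterate_succ_apply, ih, Function.iterate_succ_apply]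
      congr 1
      rw [Derivation.commutator_apply]
      by_cases h : j = i
      · subst h; simp
      · simp [MvPolynomial.pderiv_X, h]
  choose k hk using fun j => pderiv_locNil i (w (MvPolynomial.X j))
  refine ⟨Finset.univ.sup k, MvPolynomial.derivation_ext fun j => ?_⟩
  rw [key, Derivation.zero_apply]
  exact iterate_eq_zero_mono
    (MvPolynomial.pderiv i : Witt n).toLinearMap.toAddMonoidHom (Finset.le_sup (f := k) (Finset.mem_univ j))
    (hk j)

/-- `ad ∂ᵢ` is locally nilpotent on the enveloping algebra. -/
theorem del_locNil {n : ℕ} (i : Fin n) (u : UW n) : ∃ k, (adHom (del i))^[k] u = 0 := by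
  let N : Subalgebra ℂ (UW n) :=
    { carrier := {u | ∃ k, (adHom (del i))^[k] u = 0}
      mul_mem' := fun ha hb => locNil_mul _ (adHom_mul _) ha hb
      add_mem' := fun ha hb => locNil_add _ ha hb
      algebraMap_mem' := fun r => ⟨1, by
        simp [adHom_apply, Algebra.commutes]⟩ }
  have hι : ∀ w : Witt n, UniversalEnvelopingAlgebra.ι ℂ w ∈ N := by
    intro w
    obtain ⟨k, hk⟩ := witt_locNil i w
    refine ⟨k, ?_⟩
    have : ∀ (k : ℕ) (w : Witt n), (adHom (del i))^[k] (UniversalEnvelopingAlgebra.ι ℂ w) =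
        UniversalEnvelopingAlgebra.ι ℂ
          ((fun x : Witt n => ⁅(MvPolynomial.pderiv i : Witt n), x⁆)^[k] w) := by
      intro k
      induction k with
      | zero => intro w; rfl
      | succ k ih =>
        intro w
        rw [Function.iterate_succ_apply, Function.iterate_succ_apply, ← ih, LieHom.map_lie]
        rfl
    rw [this, hk, map_zero]
  let f : Witt n →ₗ⁅ℂ⁆ N :=
    { toFun := fun w => ⟨UniversalEnvelopingAlgebra.ι ℂ w, hι w⟩
      map_add' := fun a b => Subtype.ext (by simp)
      map_smul' := fun a b => Subtype.ext (by simp)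
      map_lie' := fun {a b} => Subtype.ext (by
        simp only [LieHom.map_lie]; rfl) }
  have h : N.val.comp (UniversalEnvelopingAlgebra.lift ℂ f) = AlgHom.id ℂ (UW n) := by
    apply UniversalEnvelopingAlgebra.hom_ext
    ext w
    simp [f]
  have := congrArg (fun g => g u) h
  simp only [AlgHom.comp_apply, AlgHom.id_apply] at this
  rw [← this]
  exact (UniversalEnvelopingAlgebra.lift ℂ f u).2

theorem ore_of_locNil {A : Type*} [Ring A] (s : A) (k : ℕ) :
    ∀ u : A, (adHom s)^[k] u = 0 → ∃ (a : ℕ) (r : A), s ^ a * u = r * s := by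
  induction k with
  | zero => intro u hu; exact ⟨0, 0, by simpa using hu⟩
  | succ k ih =>
    intro u hu
    obtain ⟨a, r, h⟩ := ih (adHom s u) hu
    refine ⟨a + 1, s ^ a * u + r, ?_⟩
    rw [add_mul, ← h, adHom_apply, pow_succ]; noncomm_ring

theorem cancel_of_locNil {A : Type*} [Ring A] (s : A) (k : ℕ) :
    ∀ u : A, (adHom s)^[k] u = 0 → u * s = 0 → ∃ a : ℕ, s ^ a * u = 0 := by
  induction k with
  | zero => intro u hu _; exact ⟨0, by simpa using hu⟩
  | succ k ih =>
    intro u hu hus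
    obtain ⟨a, h⟩ := ih (adHom s u) hu (by
      rw [adHom_apply, sub_mul, mul_assoc, hus]; simp)
    refine ⟨a + 1, ?_⟩
    rw [adHom_apply, hus, sub_zero] at h
    rw [pow_succ, mul_assoc, h]

theorem nonempty_oreSet (n : ℕ) : Nonempty (OreLocalization.OreSet (delSubmonoid n)) := by
  rw [OreLocalization.nonempty_oreSet_iff]
  constructor
  · rintro r₁ r₂ ⟨s, hs⟩
    change r₁ * s = r₂ * s → ∃ s' : delSubmonoid n, (s' : UW n) * r₁ = s' * r₂
    unfold delSubmonoid at hs
    induction hs using Submonoid.closure_induction generalizing r₁ r₂ with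
    | mem x hx =>
      obtain ⟨i, rfl⟩ := hx
      intro h
      obtain ⟨k, hk⟩ := del_locNil i (r₁ - r₂)
      obtain ⟨a, ha⟩ := cancel_of_locNil (del i) k _ hk (by rw [sub_mul, h, sub_self])
      refine ⟨⟨del i ^ a, pow_mem (Submonoid.subset_closure (Set.mem_range_self i)) a⟩, ?_⟩
      rw [mul_sub] at ha
      exact sub_eq_zero.mp ha
    | one => intro h; exact ⟨1, by simpa using h⟩
    | mul x y _ _ hx hy =>
      intro h
      rw [← mul_assoc, ← mul_assoc] at h
      obtain ⟨s', h'⟩ := hy _ _ h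
      rw [← mul_assoc, ← mul_assoc] at h'
      obtain ⟨s'', h''⟩ := hx _ _ h'
      exact ⟨s'' * s', by simpa [mul_assoc] using h''⟩
  · rintro r ⟨s, hs⟩
    change ∃ (r' : UW n) (s' : delSubmonoid n), (s' : UW n) * r = r' * s
    unfold delSubmonoid at hs
    induction hs using Submonoid.closure_induction generalizing r with
    | mem x hx =>
      obtain ⟨i, rfl⟩ := hx
      obtain ⟨k, hk⟩ := del_locNil i r
      obtain ⟨a, r', h⟩ := ore_of_locNil (del i) k _ hk
      exact ⟨r', ⟨del i ^ a, pow_mem (Submonoid.subset_closure (Set.mem_range_self i)) a⟩, h⟩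
    | one => exact ⟨r, 1, by simp⟩
    | mul x y _ _ hx hy =>
      obtain ⟨r', s', h'⟩ := hy r
      obtain ⟨r'', s'', h''⟩ := hx r'
      exact ⟨r'', s'' * s', by
        rw [Submonoid.coe_mul, mul_assoc, h', ← mul_assoc, h'', mul_assoc]⟩

/-- The monomials in the `∂ᵢ` form an Ore set of `U(W_n)`. -/
instance oreSet (n : ℕ) : OreLocalization.OreSet (delSubmonoid n) := (nonempty_oreSet n).some

/-- The (Ore) localization `U_∂` of `U(W_n)` at the monomials in the `∂ᵢ`. -/
abbrev UD (n : ℕ) : Type := OreLocalization (delSubmonoid n) (UW n)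

/-- The canonical algebra homomorphism `U(W_n) → U_∂`. -/
def toUD (n : ℕ) : UW n →ₐ[ℂ] UD n :=
  { OreLocalization.numeratorRingHom with commutes' := fun _ => rfl }

/-- `∂ᵢ` as a unit of `U_∂`. -/
def delUnit {n : ℕ} (i : Fin n) : (UD n)ˣ :=
  OreLocalization.numeratorUnit
    (⟨del i, Submonoid.subset_closure (Set.mem_range_self i)⟩ : delSubmonoid n)

theorem coe_delUnit {n : ℕ} (i : Fin n) : (delUnit i : UD n) = toUD n (del i) := rfl

/-- `H_n = {u ∈ U_∂ | [u, ∂ᵢ] = [u, hᵢ] = 0 for all i}`. -/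
def Hn (n : ℕ) : Subalgebra ℂ (UD n) :=
  Subalgebra.centralizer ℂ
    (Set.range (fun i : Fin n => toUD n (del i)) ∪ Set.range (fun i : Fin n => toUD n (car i)))

/-- `U(Δ_n)_∂ = ℂ[∂₁^{±1},…,∂ₙ^{±1}]` as a subalgebra of `U_∂`. -/
def DeltaLoc (n : ℕ) : Subalgebra ℂ (UD n) :=
  Algebra.adjoin ℂ
    (Set.range (fun i : Fin n => (delUnit i : UD n)) ∪
      Set.range (fun i : Fin n => ((delUnit i)⁻¹.val : UD n)))

/-- The subalgebra `H_n U(Δ_n)_∂` of `U_∂`. The two factors commute, so the subalgebra that they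
generate is the set of sums of products. -/
def Kn (n : ℕ) : Subalgebra ℂ (UD n) := Hn n ⊔ DeltaLoc n

theorem H_le_K (n : ℕ) : Hn n ≤ Kn n := le_sup_left

theorem delUnit_mem_K {n : ℕ} (i : Fin n) : (delUnit i : UD n) ∈ Kn n :=
  (le_sup_right : DeltaLoc n ≤ Kn n) (Algebra.subset_adjoin (Or.inl ⟨i, rfl⟩))

theorem H_comm_del {n : ℕ} {x : UD n} (hx : x ∈ Hn n) (i : Fin n) :
    Commute x (delUnit i : UD n) :=
  ((Subalgebra.mem_centralizer_iff ℂ).1 hx _ (Or.inl ⟨i, rfl⟩)).symm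

theorem H_comm_car {n : ℕ} {x : UD n} (hx : x ∈ Hn n) (i : Fin n) :
    Commute x (toUD n (car i)) :=
  ((Subalgebra.mem_centralizer_iff ℂ).1 hx _ (Or.inr ⟨i, rfl⟩)).symm

theorem ι_commute {n : ℕ} {x y : Witt n} (h : ⁅x, y⁆ = 0) :
    Commute (UniversalEnvelopingAlgebra.ι ℂ x) (UniversalEnvelopingAlgebra.ι ℂ y) := by
  have := LieHom.map_lie (UniversalEnvelopingAlgebra.ι ℂ) x y
  rw [h, map_zero] at this
  exact (sub_eq_zero.1 this.symm)

theorem del_commute {n : ℕ} (i j : Fin n) : Commute (del i) (del j) := by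
  refine ι_commute (MvPolynomial.derivation_ext fun k => ?_)
  simp [Derivation.commutator_apply, MvPolynomial.pderiv_X, Pi.single_apply, apply_ite]

theorem delUnit_commute {n : ℕ} (i j : Fin n) : Commute (delUnit i) (delUnit j) := by
  apply Units.ext
  simpa [coe_delUnit] using congrArg (toUD n) (del_commute i j).eq

theorem car_commute {n : ℕ} (i j : Fin n) : Commute (car i) (car j) := by
  refine ι_commute (MvPolynomial.derivation_ext fun k => ?_)
  by_cases hi : k = i <;> by_cases hj : k = j <;> by_cases hij : i = j <;>
    simp_all [Derivation.commutator_apply, MvPolynomial.pderiv_X]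

theorem car_mul_del {n : ℕ} (i j : Fin n) :
    car i * del j = del j * car i - (if i = j then (1 : ℂ) else 0) • del j := by
  have h : ⁅((MvPolynomial.X i : MvPolynomial (Fin n) ℂ) • (MvPolynomial.pderiv i : Witt n)),
      (MvPolynomial.pderiv j : Witt n)⁆ =
        -((if i = j then (1 : ℂ) else 0) • (MvPolynomial.pderiv j : Witt n)) := by
    refine MvPolynomial.derivation_ext fun k => ?_
    by_cases hi : k = i <;> by_cases hj : k = j <;> by_cases hij : i = j <;>
      simp_all [Derivation.commutator_apply, MvPolynomial.pderiv_X]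
  have h2 := LieHom.map_lie (UniversalEnvelopingAlgebra.ι ℂ)
    ((MvPolynomial.X i : MvPolynomial (Fin n) ℂ) • (MvPolynomial.pderiv i : Witt n))
    (MvPolynomial.pderiv j : Witt n)
  rw [h, map_neg, map_smul] at h2
  change _ = car i * del j - del j * car i at h2
  rw [sub_eq_add_neg, del, h2]; simp [del]

/-- `[hᵢ, g] = -c g` in `U_∂`. -/
def HasWt {n : ℕ} (i : Fin n) (c : ℂ) (g : UD n) : Prop :=
  toUD n (car i) * g = g * toUD n (car i) - c • g

theorem HasWt.one {n : ℕ} (i : Fin n) : HasWt i 0 (1 : UD n) := by simp [HasWt]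

theorem HasWt.mul {n : ℕ} {i : Fin n} {c d : ℂ} {g k : UD n} (hg : HasWt i c g)
    (hk : HasWt i d k) : HasWt i (c + d) (g * k) := by
  unfold HasWt at *
  rw [← mul_assoc, hg, sub_mul, mul_assoc, hk, mul_sub, add_smul]
  simp only [mul_assoc, smul_mul_assoc, mul_smul_comm]
  abel

theorem HasWt.inv {n : ℕ} {i : Fin n} {c : ℂ} {g : (UD n)ˣ} (hg : HasWt i c (g : UD n)) :
    HasWt i (-c) ((g⁻¹ : (UD n)ˣ) : UD n) := by
  unfold HasWt at *
  have := congrArg (fun x => ((g⁻¹ : (UD n)ˣ) : UD n) * x * ((g⁻¹ : (UD n)ˣ) : UD n)) hg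
  simp only [mul_sub, sub_mul, mul_assoc, Units.mul_inv, mul_one, smul_mul_assoc,
    mul_smul_comm, Units.inv_mul_cancel_left] at this
  rw [neg_smul, this]; abel

theorem HasWt.zpow {n : ℕ} {i : Fin n} {c : ℂ} {g : (UD n)ˣ} (hg : HasWt i c (g : UD n))
    (m : ℤ) : HasWt i (m * c) ((g ^ m : (UD n)ˣ) : UD n) := by
  induction m using Int.induction_on with
  | zero => simpa using HasWt.one i
  | succ m ih =>
    have := ih.mul hg
    rw [zpow_add, Units.val_mul, zpow_one]
    convert this using 1
    push_cast; ring
  | pred m ih =>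
    have := ih.mul hg.inv
    rw [zpow_sub, Units.val_mul, zpow_one]
    convert this using 1
    push_cast; ring

theorem hasWt_del {n : ℕ} (i j : Fin n) :
    HasWt i (if i = j then 1 else 0) (delUnit j : UD n) := by
  unfold HasWt
  rw [coe_delUnit, ← map_mul, car_mul_del, map_sub, map_mul, map_smul]

theorem HasWt.of_mem_H {n : ℕ} (i : Fin n) {x : UD n} (hx : x ∈ Hn n) : HasWt i 0 x := by
  simpa [HasWt] using (H_comm_car hx i).symm.eq

theorem zpowersHom_delUnit_commute (n : ℕ) : Pairwise fun i j : Fin n =>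
    ∀ x y : Multiplicative ℤ, Commute (zpowersHom (UD n)ˣ (delUnit i) x)
      (zpowersHom (UD n)ˣ (delUnit j) y) :=
  fun i j _ _ _ => (delUnit_commute i j).zpow_zpow _ _

/-- The group homomorphism `ℤⁿ → U_∂ˣ`, `m ↦ ∂^m`. -/
def delPow (n : ℕ) : (Fin n → Multiplicative ℤ) →* (UD n)ˣ :=
  MonoidHom.noncommPiCoprod (fun i => zpowersHom (UD n)ˣ (delUnit i))
    (zpowersHom_delUnit_commute n)

theorem delPow_mulSingle {n : ℕ} (i : Fin n) (m : Multiplicative ℤ) :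
    delPow n (Pi.mulSingle i m) = delUnit i ^ (m.toAdd) := by
  rw [delPow, MonoidHom.noncommPiCoprod_mulSingle, zpowersHom_apply]

theorem delPow_wt {n : ℕ} (i : Fin n) (m : Fin n → Multiplicative ℤ) :
    HasWt i ((m i).toAdd : ℂ) (delPow n m : UD n) := by
  have key : ∀ s : Finset (Fin n), HasWt i (if i ∈ s then ((m i).toAdd : ℂ) else 0)
      (delPow n (∏ j ∈ s, Pi.mulSingle j (m j)) : UD n) := by
    intro s
    induction s using Finset.induction_on with
    | empty => simpa using HasWt.one i
    | insert j s hj ih =>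
      rw [Finset.prod_insert hj, map_mul, Units.val_mul, delPow_mulSingle]
      convert ((hasWt_del i j).zpow (m j).toAdd).mul ih using 1
      by_cases h : i = j
      · subst h; simp [hj]
      · simp [h]
  have := key Finset.univ
  rwa [Finset.univ_prod_mulSingle, if_pos (Finset.mem_univ i)] at this

theorem H_comm_delPow {n : ℕ} {x : UD n} (hx : x ∈ Hn n) (m : Fin n → Multiplicative ℤ) :
    Commute x (delPow n m : UD n) := by
  have key : ∀ s : Finset (Fin n),
      Commute x (delPow n (∏ j ∈ s, Pi.mulSingle j (m j)) : UD n) := by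
    intro s
    induction s using Finset.induction_on with
    | empty => simp
    | insert j s hj ih =>
      rw [Finset.prod_insert hj, map_mul, Units.val_mul, delPow_mulSingle]
      exact ((H_comm_del hx j).units_zpow_right _).mul_right ih
  have := key Finset.univ
  rwa [Finset.univ_prod_mulSingle] at this

/-- The map `H_n[ℤⁿ] → U_∂`. -/
def groupMap (n : ℕ) : MonoidAlgebra (Hn n) (Fin n → Multiplicative ℤ) →ₐ[ℂ] UD n :=
  MonoidAlgebra.liftNCAlgHom (Hn n).val ((Units.coeHom (UD n)).comp (delPow n))
    (fun x m => H_comm_delPow x.2 m)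

theorem groupMap_single {n : ℕ} (m : Fin n → Multiplicative ℤ) (x : Hn n) :
    groupMap n (MonoidAlgebra.single m x) = x * (delPow n m : UD n) := by
  exact MonoidAlgebra.liftNC_single _ _ _ _

/-- Commutator with `hᵢ` as a linear endomorphism. -/
def adCar {n : ℕ} (i : Fin n) : Module.End ℂ (UD n) :=
  LinearMap.mulLeft ℂ (toUD n (car i)) - LinearMap.mulRight ℂ (toUD n (car i))

theorem commute_commutators {A : Type*} [Ring A] [Algebra ℂ A] {a b : A} (h : Commute a b) :
    Commute (LinearMap.mulLeft ℂ a - LinearMap.mulRight ℂ a)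
      (LinearMap.mulLeft ℂ b - LinearMap.mulRight ℂ b) := by
  refine LinearMap.ext fun x => ?_
  simp only [Module.End.mul_apply, LinearMap.sub_apply, LinearMap.mulLeft_apply,
    LinearMap.mulRight_apply, mul_sub, sub_mul]
  rw [← mul_assoc, h.eq, mul_assoc x, mul_assoc x, h.eq]
  simp only [mul_assoc]
  abel

theorem adCar_commute {n : ℕ} (i j : Fin n) : Commute (adCar i) (adCar j) := by
  have h : Commute (toUD n (car i)) (toUD n (car j)) := (car_commute i j).map (toUD n)
  exact commute_commutators h

theorem groupMap_injective (n : ℕ) : Function.Injective (groupMap n) := by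
  classical
  rw [injective_iff_map_eq_zero]
  intro a ha
  have hind := Module.End.independent_iInf_maxGenEigenspace_of_forall_mapsTo
    (fun i : Fin n => adCar i)
    (fun i j φ => Module.End.mapsTo_maxGenEigenspace_of_comm (adCar_commute j i) φ)
  let χ : (Fin n → Multiplicative ℤ) → (Fin n → ℂ) := fun m i => -((m i).toAdd : ℂ)
  have hχ : Function.Injective χ := by
    intro m m' h
    funext i
    have := congrFun h i
    simpa [χ] using this
  have hind2 := (iSupIndep_iff_finsetSum_eq_zero_imp_eq_zero _).1 (hind.comp hχ)
    a.coeff.support (fun m => (a.coeff m : UD n) * (delPow n m : UD n)) (fun m _ => ?_) ?_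
  · ext m
    by_contra hm
    have h0 := hind2 m (Finsupp.mem_support_iff.2 fun h => hm (by rw [h]; rfl))
    rw [Units.mul_left_eq_zero] at h0
    exact hm h0
  · rw [Function.comp_apply, Submodule.mem_iInf]
    intro i
    refine Module.End.mem_maxGenEigenspace _ _ _ |>.2 ⟨1, ?_⟩
    have hw := (HasWt.of_mem_H i (a.coeff m).2).mul (delPow_wt i m)
    rw [zero_add] at hw
    unfold HasWt at hw
    simp only [pow_one, LinearMap.sub_apply, adCar, LinearMap.mulLeft_apply,
      LinearMap.mulRight_apply, LinearMap.smul_apply, Module.End.one_apply, χ]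
    rw [hw, neg_smul]
    abel
  · rw [← ha]
    conv_rhs => rw [← MonoidAlgebra.sum_coeff_single a]
    rw [Finsupp.sum, map_sum]
    exact Finset.sum_congr rfl fun m _ => (groupMap_single m _).symm

theorem K_le_range (n : ℕ) : Kn n ≤ (groupMap n).range := by
  refine sup_le (fun x hx => ?_) (Algebra.adjoin_le ?_)
  · exact ⟨MonoidAlgebra.single 1 ⟨x, hx⟩, by simp [groupMap_single]⟩
  · rintro _ (⟨i, rfl⟩ | ⟨i, rfl⟩)
    · exact ⟨MonoidAlgebra.single (Pi.mulSingle i (Multiplicative.ofAdd 1)) 1, by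
        simp [groupMap_single, delPow_mulSingle]⟩
    · exact ⟨MonoidAlgebra.single (Pi.mulSingle i (Multiplicative.ofAdd (-1))) 1, by
        simp [groupMap_single, delPow_mulSingle]⟩

/-- The augmentation `H_n[ℤⁿ] → H_n`. -/
def augment (n : ℕ) : MonoidAlgebra (Hn n) (Fin n → Multiplicative ℤ) →ₐ[ℂ] Hn n :=
  MonoidAlgebra.liftNCAlgHom (AlgHom.id ℂ (Hn n)) 1 (fun _ _ => Commute.one_right _)

theorem augment_single {n : ℕ} (m : Fin n → Multiplicative ℤ) (x : Hn n) :
    augment n (MonoidAlgebra.single m x) = x := by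
  refine (MonoidAlgebra.liftNC_single _ _ _ _).trans ?_
  simp

/-- The algebra homomorphism `H_n U(Δ_n)_∂ → H_n` which is the identity on `H_n` and sends every
`∂ᵢ` to `1`. An `H_n`-module `V` becomes along it the `H_n U(Δ_n)_∂`-module that extends the given
action by `∂ᵢ v = v`. -/
def eps (n : ℕ) : Kn n →ₐ[ℂ] Hn n :=
  ((augment n).comp (AlgEquiv.ofInjective (groupMap n) (groupMap_injective n)).symm.toAlgHom).comp
    (Subalgebra.inclusion (K_le_range n))

theorem eps_groupMap {n : ℕ} (k : Kn n) (a : MonoidAlgebra (Hn n) (Fin n → Multiplicative ℤ))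
    (h : groupMap n a = k) : eps n k = augment n a := by
  change augment n ((AlgEquiv.ofInjective (groupMap n) (groupMap_injective n)).symm _) = _
  congr 1
  rw [AlgEquiv.symm_apply_eq]
  exact Subtype.ext h.symm

theorem eps_of_mem_H {n : ℕ} (x : Hn n) : eps n ⟨x, H_le_K n x.2⟩ = x := by
  rw [eps_groupMap _ (MonoidAlgebra.single 1 x) (by simp [groupMap_single]), augment_single]

theorem eps_del {n : ℕ} (i : Fin n) : eps n ⟨delUnit i, delUnit_mem_K i⟩ = 1 := by
  rw [eps_groupMap _ (MonoidAlgebra.single (Pi.mulSingle i (Multiplicative.ofAdd 1)) 1)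
    (by simp [groupMap_single, delPow_mulSingle]), augment_single]

open scoped ModuleCat

/-- Every `∂ᵢ - 1` acts locally nilpotently on the `W_n`-module `M`. (A `W_n`-module is a left
`U(W_n)`-module.) -/
def IsLocNil (n : ℕ) (M : ModuleCat.{v} (UW n)) : Prop :=
  ∀ (m : M) (i : Fin n), ∃ k : ℕ, 0 < k ∧ (del i - 1) ^ k • m = 0

/-- `wh_𝟏(M)`: the space of Whittaker vectors, i.e. of the `m ∈ M` with `∂ᵢ m = m` for all `i`. -/
def wh (n : ℕ) (M : ModuleCat.{v} (UW n)) : Submodule ℂ M where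
  carrier := {m | ∀ i : Fin n, del i • m = m}
  add_mem' ha hb i := by rw [smul_add, ha i, hb i]
  zero_mem' i := smul_zero _
  smul_mem' c m hm i := by rw [smul_comm, hm i]

/-- The objects of `Ω_𝟏`: every `∂ᵢ - 1` is locally nilpotent, and `wh_𝟏(M)` is
finite dimensional. -/
def IsWhittaker (n : ℕ) : ObjectProperty (ModuleCat.{v} (UW n)) := fun M =>
  IsLocNil n M ∧ Module.Finite ℂ (wh n M)

/-- The category `Ω_𝟏`, a full subcategory of the category of `W_n`-modules. -/
abbrev Omega (n : ℕ) : Type (v + 1) := (IsWhittaker.{v} n).FullSubcategory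

/-- The `H_n`-module `V` is finite dimensional over `ℂ`. -/
def IsFinDim (n : ℕ) : ObjectProperty (ModuleCat.{v} (Hn n)) := fun V => Module.Finite ℂ V

/-- The category of finite-dimensional `H_n`-modules. -/
abbrev FinHMod (n : ℕ) : Type (v + 1) := (IsFinDim.{v} n).FullSubcategory

theorem isUnit_of_locNil {V : Type*} [AddCommGroup V] [Module ℂ V] (T : Module.End ℂ V)
    (h : ∀ v, ∃ k : ℕ, ((1 - T) ^ k) v = 0) : IsUnit T := by
  have hT : T = 1 - (1 - T) := by abel
  rw [Module.End.isUnit_iff]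
  constructor
  · rw [injective_iff_map_eq_zero]
    intro v hv
    obtain ⟨k, hk⟩ := h v
    have h1 : ∀ k : ℕ, ((1 - T) ^ k) v = v := by
      intro k
      induction k with
      | zero => rfl
      | succ k ih => rw [pow_succ, Module.End.mul_apply, LinearMap.sub_apply, hv]; simpa using ih
    rw [← h1 k, hk]
  · intro v
    obtain ⟨k, hk⟩ := h v
    refine ⟨(∑ i ∈ Finset.range k, (1 - T) ^ i) v, ?_⟩
    rw [← Module.End.mul_apply]
    have := mul_neg_geom_sum (1 - T) k
    rw [← hT] at this
    rw [this, LinearMap.sub_apply, hk, sub_zero, Module.End.one_apply]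

/-- The action of the enveloping algebra as an algebra homomorphism. -/
def act {n : ℕ} (M : ModuleCat.{v} (UW n)) : UW n →ₐ[ℂ] Module.End ℂ M :=
  Algebra.lsmul ℂ ℂ M

theorem act_apply {n : ℕ} (M : ModuleCat.{v} (UW n)) (u : UW n) (m : M) : act M u m = u • m := rfl

theorem isUnit_delSubmonoid {n : ℕ} {M : ModuleCat.{v} (UW n)} (hM : IsLocNil n M)
    (s : delSubmonoid n) : IsUnit (act M (s : UW n)) := by
  obtain ⟨s, hs⟩ := s
  change IsUnit (act M s)
  unfold delSubmonoid at hs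
  induction hs using Submonoid.closure_induction with
  | mem x hx =>
    obtain ⟨i, rfl⟩ := hx
    refine isUnit_of_locNil _ fun m => ?_
    obtain ⟨k, -, hk⟩ := hM m i
    refine ⟨k, ?_⟩
    rw [← map_one (act M), ← map_sub, ← map_pow, act_apply, ← neg_sub, neg_pow, mul_smul, hk,
      smul_zero]
  | one => rw [map_one]; exact isUnit_one
  | mul x y _ _ hx hy => rw [map_mul]; exact hx.mul hy

/-- The submonoid generated by the `∂ᵢ` acts by invertible operators. -/
def delAct {n : ℕ} {M : ModuleCat.{v} (UW n)} (hM : IsLocNil n M) :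
    delSubmonoid n →* (Module.End ℂ M)ˣ :=
  IsUnit.liftRight (((act M : UW n →* Module.End ℂ M)).comp (delSubmonoid n).subtype)
    (isUnit_delSubmonoid hM)

theorem coe_delAct {n : ℕ} {M : ModuleCat.{v} (UW n)} (hM : IsLocNil n M) (s : delSubmonoid n) :
    (act M : UW n →+* Module.End ℂ M) s = delAct hM s := rfl

/-- If every `∂ᵢ - 1` is locally nilpotent on `M`, then every `∂ᵢ` is invertible on `M`, and the
action of `U(W_n)` extends uniquely to `U_∂`. -/
def locAct {n : ℕ} {M : ModuleCat.{v} (UW n)} (hM : IsLocNil n M) :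
    UD n →+* Module.End ℂ M :=
  OreLocalization.universalHom (act M : UW n →+* Module.End ℂ M) (delAct hM) (coe_delAct hM)

theorem locAct_toUD {n : ℕ} {M : ModuleCat.{v} (UW n)} (hM : IsLocNil n M) (u : UW n) (m : M) :
    locAct hM (toUD n u) m = u • m :=
  LinearMap.congr_fun (OreLocalization.universalHom_commutes (act M : UW n →+* Module.End ℂ M)
    (delAct hM) (coe_delAct hM) (r := u)) m

theorem locAct_map {n : ℕ} {M N : ModuleCat.{v} (UW n)} (hM : IsLocNil n M) (hN : IsLocNil n N)
    (f : M ⟶ N) (x : UD n) (m : M) :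
    f.hom (locAct hM x m) = locAct hN x (f.hom m) := by
  induction x using OreLocalization.ind with
  | _ r s =>
  have hx : ∀ {P : ModuleCat.{v} (UW n)} (hP : IsLocNil n P) (p : P),
      (s : UW n) • locAct hP (OreLocalization.oreDiv r s) p = r • p := by
    intro P hP p
    rw [← locAct_toUD hP, ← locAct_toUD hP, ← Module.End.mul_apply, ← map_mul]
    congr 2
    exact OreLocalization.mul_cancel
  have hinj : Function.Injective (fun p : N => (s : UW n) • p) :=
    ((Module.End.isUnit_iff _).1 (isUnit_delSubmonoid hN s)).1
  apply hinj
  change (s : UW n) • _ = (s : UW n) • _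
  rw [hx, ← map_smul, hx, map_smul]

theorem locAct_mem_wh {n : ℕ} {M : ModuleCat.{v} (UW n)} (hM : IsLocNil n M) {x : UD n}
    (hx : x ∈ Hn n) {m : M} (hm : m ∈ wh n M) : locAct hM x m ∈ wh n M := by
  intro i
  rw [← locAct_toUD hM, ← Module.End.mul_apply, ← map_mul, ← coe_delUnit,
    ← (H_comm_del hx i).eq, map_mul, Module.End.mul_apply, coe_delUnit, locAct_toUD, hm i]

/-- `H_n ⊆ U_∂` acts on `wh_𝟏(M)`, for `M` in `Ω_𝟏`. -/
instance whModule {n : ℕ} (M : Omega.{v} n) : Module (Hn n) (wh n M.obj) where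
  smul x m := ⟨locAct M.property.1 x m, locAct_mem_wh M.property.1 x.2 m.2⟩
  one_smul m := Subtype.ext (by
    change locAct M.property.1 1 (m : M.obj) = m
    rw [map_one]; rfl)
  mul_smul x y m := Subtype.ext (by
    change locAct M.property.1 ((x : UD n) * y) (m : M.obj) = _
    rw [map_mul]; rfl)
  smul_zero x := Subtype.ext (map_zero _)
  smul_add x a b := Subtype.ext (map_add _ _ _)
  add_smul x y m := Subtype.ext (by
    change locAct M.property.1 ((x : UD n) + y) (m : M.obj) = _
    rw [map_add]; rfl)
  zero_smul m := Subtype.ext (by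
    change locAct M.property.1 0 (m : M.obj) = _
    rw [map_zero]; rfl)

theorem wh_smul_coe {n : ℕ} (M : Omega.{v} n) (x : Hn n) (m : wh n M.obj) :
    ((x • m : wh n M.obj) : M.obj) = locAct M.property.1 x m := rfl

theorem finite_of_surjective {R : Type} [Ring R] [Algebra ℂ R] {P : Type v} [AddCommGroup P]
    [Module ℂ P] [Module.Finite ℂ P] (W : ModuleCat.{v} R) (f : P →+ W)
    (hf : Function.Surjective f) (hs : ∀ (c : ℂ) (p : P), f (c • p) = algebraMap ℂ R c • f p) :
    Module.Finite ℂ W :=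
  Module.Finite.of_surjective
    ({ f with map_smul' := fun c p => (hs c p).trans (algebraMap_smul R c (f p)) } : P →ₗ[ℂ] W) hf

theorem wh_finDim {n : ℕ} (M : Omega.{v} n) :
    IsFinDim n (ModuleCat.of (Hn n) (wh n M.obj)) := by
  have := M.property.2
  refine finite_of_surjective _ (AddMonoidHom.id (wh n M.obj)) Function.surjective_id
    fun c m => Subtype.ext ?_
  change c • (m : M.obj) = locAct M.property.1 (toUD n (algebraMap ℂ (UW n) c)) (m : M.obj)
  rw [locAct_toUD, algebraMap_smul]

/-- The functor `M ↦ wh_𝟏(M)` from `Ω_𝟏` to finite-dimensional `H_n`-modules; on morphisms it is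
restriction. -/
def whFunctor (n : ℕ) : Omega.{v} n ⥤ FinHMod.{v} n where
  obj M := ⟨ModuleCat.of (Hn n) (wh n M.obj), wh_finDim M⟩
  map {M N} f := ObjectProperty.homMk (ModuleCat.ofHom
    { toFun := fun m => ⟨f.hom.hom m, fun i => by rw [← map_smul, m.2 i]⟩
      map_add' := fun a b => Subtype.ext (map_add _ _ _)
      map_smul' := fun x m => Subtype.ext
        (locAct_map M.property.1 N.property.1 f.hom (x : UD n) (m : M.obj)) })
  map_id _ := rfl
  map_comp _ _ := rfl

section Induction

variable {A : Type} [Ring A] [Algebra ℂ A] (B : Subalgebra ℂ A)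

/-- The `A`-submodule of `A ⊗_ℂ V` generated by the `a b ⊗ x - a ⊗ b x` with `b ∈ B`. -/
def balanced (V : ModuleCat.{v} B) : Submodule A (A ⊗[ℂ] V) :=
  Submodule.span A {z | ∃ (a : A) (b : B) (x : V),
    z = (a * (b : A)) ⊗ₜ[ℂ] x - a ⊗ₜ[ℂ] (b • x)}

/-- The induced module `A ⊗_B V`, for a subalgebra `B` of `A` and a left `B`-module `V`. -/
def Ind (V : ModuleCat.{v} B) : Type v := (A ⊗[ℂ] V) ⧸ balanced B V

instance (V : ModuleCat.{v} B) : AddCommGroup (Ind B V) :=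
  inferInstanceAs (AddCommGroup ((A ⊗[ℂ] V) ⧸ balanced B V))

instance (V : ModuleCat.{v} B) : Module A (Ind B V) :=
  inferInstanceAs (Module A ((A ⊗[ℂ] V) ⧸ balanced B V))

/-- `id ⊗ f` on `A ⊗_ℂ V`. -/
def tensorMap {V W : ModuleCat.{v} B} (f : V ⟶ W) : A ⊗[ℂ] V →ₗ[A] A ⊗[ℂ] W :=
  TensorProduct.AlgebraTensorModule.map LinearMap.id (f.hom.restrictScalars ℂ)

theorem balanced_le {V W : ModuleCat.{v} B} (f : V ⟶ W) :
    balanced B V ≤ (balanced B W).comap (tensorMap B f) := by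
  refine Submodule.span_le.2 ?_
  rintro _ ⟨a, b, x, rfl⟩
  refine Submodule.subset_span ⟨a, b, f.hom x, ?_⟩
  simp [tensorMap]

/-- `id ⊗ f` on `A ⊗_B V`. -/
def indMap {V W : ModuleCat.{v} B} (f : V ⟶ W) : Ind B V →ₗ[A] Ind B W :=
  Submodule.mapQ _ _ (tensorMap B f) (balanced_le B f)

theorem ind_hom_ext {V : ModuleCat.{v} B} {P : Type*} [AddCommGroup P] [Module A P]
    {f g : Ind B V →ₗ[A] P}
    (h : ∀ x : V, f (Submodule.Quotient.mk (1 ⊗ₜ x)) = g (Submodule.Quotient.mk (1 ⊗ₜ x))) :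
    f = g := by
  let : Module ℂ P := Module.restrictScalars ℂ A P
  have : IsScalarTower ℂ A P := IsScalarTower.restrictScalars ℂ A P
  refine Submodule.linearMap_qext _ (TensorProduct.AlgebraTensorModule.ext fun a x => ?_)
  have : a ⊗ₜ[ℂ] x = a • ((1 : A) ⊗ₜ[ℂ] x) := by simp [TensorProduct.smul_tmul']
  rw [this, map_smul, map_smul]
  exact congrArg (a • ·) (h x)

/-- Induction `V ↦ A ⊗_B V` as a functor from left `B`-modules to left `A`-modules. -/
def tensorFunctor : ModuleCat.{v} B ⥤ ModuleCat.{v} A where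
  obj V := ModuleCat.of A (Ind B V)
  map f := ModuleCat.ofHom (indMap B f)
  map_id V := by
    ext1
    exact ind_hom_ext B fun x => rfl
  map_comp f g := by
    ext1
    exact ind_hom_ext B fun x => rfl

end Induction

/-- `V ↦ U_∂ ⊗_{H_n U(Δ_n)_∂} V`, where `∂ᵢ v = v` on the finite-dimensional `H_n`-module `V`; the
result is viewed as a `W_n`-module through `U(W_n) → U_∂`. -/
def inductionFunctor (n : ℕ) : FinHMod.{v} n ⥤ ModuleCat.{v} (UW n) :=
  (IsFinDim n).ι ⋙ ModuleCat.restrictScalars (eps n).toRingHom ⋙ tensorFunctor (Kn n) ⋙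
    ModuleCat.restrictScalars (toUD n).toRingHom

end WittWhittaker

end

/-!
Write `xⱼ = hⱼ ∂ⱼ⁻¹ ∈ U_∂`. Then `[∂ᵢ, xⱼ] = δᵢⱼ`, so `U_∂` contains a Weyl algebra, and the
`[∂ᵢ, -]` are locally nilpotent on `U_∂`. The argument is Kashiwara's lemma for the two resulting
actions: on `U_∂` by the `[∂ᵢ, -]` and left multiplication by the `xⱼ`, and on a module `M` on which
the `∂ᵢ - 1` are locally nilpotent by the `∂ᵢ - 1` and the `xⱼ`. Both are instances of
`IsWeylFamily`. For commuting locally nilpotent `Dᵢ` and operators `Xⱼ` with `[Dᵢ, Xⱼ] = δᵢⱼ`,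
composing the operators `∑_k (-1)^k / k! Xᵢ^k Dᵢ^k` gives a projection `IsWeylFamily.proj` onto the
joint kernel of the `Dᵢ`; it commutes with every map that intertwines the two families. Moreover the
joint kernel generates under the `Xⱼ` (`IsWeylFamily.eq_top_of_stable`) and meets every nonzero
`D`-stable subspace (`IsWeylFamily.eq_bot_of_stable`).

On `U_∂` the joint kernel is the centralizer of the `∂ᵢ`, and this is `H_n U(Δ_n)_∂`: since `U_∂` is
spanned by vectors of integral weight for the `hᵢ` and the projection preserves weights, the
centralizer is spanned by weight vectors, and a monomial in the `∂ᵢ^{±1}` moves each of them to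
weight `0`, that is, into `H_n` (`proj_mem_K`). Thus `H_n U(Δ_n)_∂` is a direct summand of `U_∂` as
a right module over itself, which makes `V → U_∂ ⊗ V` injective. No basis of `U(W_n)` is needed.

On `U_∂ ⊗ V` the operator `∂ᵢ - 1` sends `a ⊗ v` to `[∂ᵢ, a] ⊗ v`. Hence it is locally nilpotent,
and the projection onto the Whittaker vectors sends `a ⊗ v` to `proj a ⊗ v ∈ 1 ⊗ V`, so that
`V ≅ wh_𝟏(U_∂ ⊗ V)` (`whUnit_bijective`). The map `U_∂ ⊗ wh_𝟏(M) → M` is injective, because its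
kernel contains no nonzero Whittaker vector, and surjective, because `wh_𝟏(M)` generates `M` under
the `xⱼ` (`whCounit_bijective`).
-/

noncomputable section
namespace WittWhittaker
open scoped TensorProduct ModuleCat
attribute [local instance] LieRing.ofAssociativeRing

/-! ### Kashiwara's lemma for locally nilpotent operators -/

section Weyl

variable {F E E' : Type*} [Field F] [AddCommGroup E] [Module F E]
  [AddCommGroup E'] [Module F E']

open scoped Nat in
/-- The partial sum `∑_{k < N} (-1)^k / k! X^k D^k` of the Taylor expansion that extracts the
constant term with respect to `X`. -/
def taylorSum (D X : Module.End F E) (N : ℕ) : Module.End F E :=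
  ∑ k ∈ Finset.range N, ((-1) ^ k / (k ! : F)) • (X ^ k * D ^ k)

theorem mul_pow_of_weyl {D X : Module.End F E} (h : D * X = X * D + 1) (k : ℕ) :
    D * X ^ (k + 1) = X ^ (k + 1) * D + (k + 1 : F) • X ^ k := by
  induction k with
  | zero => simp [h]
  | succ k ih =>
    rw [pow_succ, ← mul_assoc, ih, add_mul, mul_assoc, h, mul_add, mul_one, ← mul_assoc,
      ← pow_succ, smul_mul_assoc, ← pow_succ, add_assoc]
    congr 1
    push_cast
    module

open scoped Nat in
/-- Multiplied by `D`, the sum telescopes to its last term, which vanishes on `ker D^(N+1)`. -/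
theorem mul_taylorSum [CharZero F] {D X : Module.End F E} (h : D * X = X * D + 1) (N : ℕ) :
    D * taylorSum D X (N + 1) = ((-1) ^ N / (N ! : F)) • (X ^ N * D ^ (N + 1)) := by
  induction N with
  | zero => simp [taylorSum]
  | succ N ih =>
    rw [taylorSum, Finset.sum_range_succ, ← taylorSum, mul_add, ih, mul_smul_comm, ← mul_assoc,
      mul_pow_of_weyl h, add_mul, mul_assoc (X ^ (N + 1)), ← pow_succ', smul_mul_assoc, smul_add,
      smul_smul, ← add_assoc, add_right_comm, ← add_smul]
    have : ((-1) ^ N / (N ! : F)) + (-1) ^ (N + 1) / ((N + 1)! : F) * (N + 1) = 0 := by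
      rw [Nat.factorial_succ]
      have h1 : (N ! : F) ≠ 0 := by exact_mod_cast N.factorial_ne_zero
      have h2 : (N + 1 : F) ≠ 0 := by exact_mod_cast N.succ_ne_zero
      push_cast
      field_simp
      ring
    rw [this, zero_smul, zero_add]

theorem end_pow_eq_zero_mono {D : Module.End F E} {k l : ℕ} (hkl : k ≤ l) {e : E}
    (h : (D ^ k) e = 0) : (D ^ l) e = 0 := by
  obtain ⟨m, rfl⟩ := Nat.exists_eq_add_of_le hkl
  rw [add_comm, pow_add, Module.End.mul_apply, h, map_zero]

theorem taylorSum_eq_of_le {D X : Module.End F E} {N M : ℕ} (hNM : N ≤ M) {e : E}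
    (h : (D ^ N) e = 0) : taylorSum D X M e = taylorSum D X N e := by
  induction M, hNM using Nat.le_induction with
  | base => rfl
  | succ M hM ih =>
    rw [taylorSum, Finset.sum_range_succ, LinearMap.add_apply, ← taylorSum, ih,
      LinearMap.smul_apply, Module.End.mul_apply, end_pow_eq_zero_mono hM h]
    simp

/-- The operator `∑_k (-1)^k / k! X^k D^k`, for locally nilpotent `D`. If `[D, X] = 1`, it is the
projection onto `ker D` along the image of `X`. At `e` it is the partial sum up to any `N` with
`D^N e = 0`. -/
def constTerm (D X : Module.End F E) (hD : ∀ e, ∃ k, (D ^ k) e = 0) : Module.End F E :=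
  have key (e : E) {N : ℕ} (h : (D ^ N) e = 0) :
      taylorSum D X (hD e).choose e = taylorSum D X N e := by
    rcases le_total N (hD e).choose with hN | hN
    · exact taylorSum_eq_of_le hN h
    · exact (taylorSum_eq_of_le hN (hD e).choose_spec).symm
  { toFun := fun e => taylorSum D X (hD e).choose e
    map_add' := fun a b => by
      have ha := end_pow_eq_zero_mono (le_max_left _ (hD b).choose) (hD a).choose_spec
      have hb := end_pow_eq_zero_mono (le_max_right (hD a).choose _) (hD b).choose_spec
      rw [key (a + b) (by rw [map_add, ha, hb, add_zero]), key a ha, key b hb, map_add]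
    map_smul' := fun c a => by
      rw [key (c • a) (N := (hD a).choose) (by rw [map_smul, (hD a).choose_spec, smul_zero]),
        map_smul, RingHom.id_apply] }

theorem constTerm_apply {D X : Module.End F E} (hD : ∀ e, ∃ k, (D ^ k) e = 0) {e : E} {N : ℕ}
    (h : (D ^ N) e = 0) : constTerm D X hD e = taylorSum D X N e := by
  change taylorSum D X (hD e).choose e = _
  rcases le_total N (hD e).choose with hN | hN
  · exact taylorSum_eq_of_le hN h
  · exact (taylorSum_eq_of_le hN (hD e).choose_spec).symm

theorem apply_constTerm [CharZero F] {D X : Module.End F E} (hD : ∀ e, ∃ k, (D ^ k) e = 0)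
    (h : D * X = X * D + 1) (e : E) : D (constTerm D X hD e) = 0 := by
  obtain ⟨k, hk⟩ := hD e
  have hk' := end_pow_eq_zero_mono k.le_succ hk
  rw [constTerm_apply hD hk', ← Module.End.mul_apply, mul_taylorSum h, LinearMap.smul_apply,
    Module.End.mul_apply, hk', map_zero, smul_zero]

theorem constTerm_of_apply_eq_zero {D X : Module.End F E} (hD : ∀ e, ∃ k, (D ^ k) e = 0) {e : E}
    (he : D e = 0) : constTerm D X hD e = e := by
  rw [constTerm_apply hD (N := 1) (by simpa using he)]
  simp [taylorSum]

theorem constTerm_mem {D X : Module.End F E} (hD : ∀ e, ∃ k, (D ^ k) e = 0) (S : Submodule F E)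
    {e : E} (h : ∀ k, (X ^ k) ((D ^ k) e) ∈ S) : constTerm D X hD e ∈ S := by
  obtain ⟨k, hk⟩ := hD e
  rw [constTerm_apply hD hk, taylorSum, LinearMap.sum_apply]
  exact S.sum_mem fun i _ => S.smul_mem _ (h i)

theorem sub_constTerm_mem {D X : Module.End F E} (hD : ∀ e, ∃ k, (D ^ k) e = 0)
    (S : Submodule F E) {e : E} (h : ∀ k, (X ^ (k + 1)) ((D ^ (k + 1)) e) ∈ S) :
    e - constTerm D X hD e ∈ S := by
  obtain ⟨k, hk⟩ := hD e
  rw [constTerm_apply hD (end_pow_eq_zero_mono k.le_succ hk), taylorSum, LinearMap.sum_apply,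
    Finset.sum_range_succ', ← S.neg_mem_iff]
  simpa using S.sum_mem fun i _ => S.smul_mem _ (h i)

theorem map_pow_apply_of_intertwine {A : Module.End F E} {A' : Module.End F E'} (f : E →ₗ[F] E')
    (h : ∀ e, f (A e) = A' (f e)) (k : ℕ) (e : E) : f ((A ^ k) e) = (A' ^ k) (f e) := by
  induction k generalizing e with
  | zero => rfl
  | succ k ih => rw [pow_succ, Module.End.mul_apply, ih, h, pow_succ, Module.End.mul_apply]

theorem map_constTerm {D X : Module.End F E} (hD : ∀ e, ∃ k, (D ^ k) e = 0)
    {D' X' : Module.End F E'} (hD' : ∀ e, ∃ k, (D' ^ k) e = 0) (f : E →ₗ[F] E')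
    (hfD : ∀ e, f (D e) = D' (f e)) (hfX : ∀ e, f (X e) = X' (f e)) (e : E) :
    f (constTerm D X hD e) = constTerm D' X' hD' (f e) := by
  obtain ⟨k, hk⟩ := hD e
  have hk' : (D' ^ k) (f e) = 0 := by
    rw [← map_pow_apply_of_intertwine f hfD, hk, map_zero]
  rw [constTerm_apply hD hk, constTerm_apply hD' hk']
  simp [taylorSum, map_pow_apply_of_intertwine f hfD, map_pow_apply_of_intertwine f hfX]

variable {ι : Type*}

/-- Commuting locally nilpotent operators `Dᵢ` and operators `Xᵢ` with `[Dᵢ, Xⱼ] = δᵢⱼ`. The `Xᵢ`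
need not commute with each other. -/
structure IsWeylFamily (D X : ι → Module.End F E) : Prop where
  weyl : ∀ i, D i * X i = X i * D i + 1
  comm_X : ∀ i j, i ≠ j → Commute (D i) (X j)
  comm_D : ∀ i j, Commute (D i) (D j)
  locNil : ∀ i e, ∃ k, (D i ^ k) e = 0

namespace IsWeylFamily

variable {D X : ι → Module.End F E} {D' X' : ι → Module.End F E'}

/-- The composite over `i ∈ l` of the projections onto `ker Dᵢ`, as an auxiliary for `proj`. The
list fixes an order of the factors. -/
def listProj (h : IsWeylFamily D X) (l : List ι) : Module.End F E :=
  (l.map fun i => constTerm (D i) (X i) (h.locNil i)).prod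

theorem listProj_cons (h : IsWeylFamily D X) (i : ι) (l : List ι) (e : E) :
    h.listProj (i :: l) e = constTerm (D i) (X i) (h.locNil i) (h.listProj l e) := by
  simp [listProj]

theorem apply_constTerm_of_ne (h : IsWeylFamily D X) {i j : ι} (hij : i ≠ j) (e : E) :
    D i (constTerm (D j) (X j) (h.locNil j) e) = constTerm (D j) (X j) (h.locNil j) (D i e) :=
  map_constTerm _ _ (D i) (fun e => LinearMap.congr_fun (h.comm_D i j).eq e)
    (fun e => LinearMap.congr_fun (h.comm_X i j hij).eq e) e

theorem apply_listProj [CharZero F] (h : IsWeylFamily D X) {l : List ι} {i : ι} (hi : i ∈ l) (e : E) :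
    D i (h.listProj l e) = 0 := by
  induction l with
  | nil => simp at hi
  | cons j l ih =>
    rw [listProj_cons]
    by_cases hij : i = j
    · subst hij
      exact apply_constTerm _ (h.weyl i) _
    · rw [h.apply_constTerm_of_ne hij, ih ((List.mem_cons.1 hi).resolve_left hij), map_zero]

theorem listProj_of_apply_eq_zero (h : IsWeylFamily D X) (l : List ι) {e : E}
    (he : ∀ i, D i e = 0) : h.listProj l e = e := by
  induction l with
  | nil => rfl
  | cons j l ih => rw [listProj_cons, ih, constTerm_of_apply_eq_zero _ (he j)]

theorem map_listProj (h : IsWeylFamily D X) (h' : IsWeylFamily D' X') (f : E →ₗ[F] E')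
    (hfD : ∀ i e, f (D i e) = D' i (f e)) (hfX : ∀ i e, f (X i e) = X' i (f e)) (l : List ι)
    (e : E) : f (h.listProj l e) = h'.listProj l (f e) := by
  induction l with
  | nil => rfl
  | cons j l ih =>
    rw [listProj_cons, listProj_cons, map_constTerm _ (h'.locNil j) f (hfD j) (hfX j), ih]

theorem listProj_mem (h : IsWeylFamily D X) (S : Submodule F E)
    (hS : ∀ i k, ∀ e ∈ S, (X i ^ k) ((D i ^ k) e) ∈ S) (l : List ι) {e : E} (he : e ∈ S) :
    h.listProj l e ∈ S := by
  induction l with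
  | nil => exact he
  | cons j l ih =>
    rw [listProj_cons]
    exact constTerm_mem _ S fun k => hS j k _ ih

variable [Fintype ι]

/-- The projection onto the joint kernel of the `Dᵢ` (along the sum of the images of the `Xᵢ`). -/
def proj (h : IsWeylFamily D X) : Module.End F E := h.listProj Finset.univ.toList

theorem apply_proj [CharZero F] (h : IsWeylFamily D X) (i : ι) (e : E) : D i (h.proj e) = 0 :=
  h.apply_listProj (Finset.mem_toList.2 (Finset.mem_univ i)) e

theorem proj_of_apply_eq_zero (h : IsWeylFamily D X) {e : E} (he : ∀ i, D i e = 0) :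
    h.proj e = e :=
  h.listProj_of_apply_eq_zero _ he

theorem map_proj (h : IsWeylFamily D X) (h' : IsWeylFamily D' X') (f : E →ₗ[F] E')
    (hfD : ∀ i e, f (D i e) = D' i (f e)) (hfX : ∀ i e, f (X i e) = X' i (f e)) (e : E) :
    f (h.proj e) = h'.proj (f e) :=
  h.map_listProj h' f hfD hfX _ e

/-- The joint kernel of the `Dᵢ` generates under the `Xᵢ`. -/
theorem eq_top_of_stable [CharZero F] (h : IsWeylFamily D X) (S : Submodule F E)
    (hS : ∀ e, (∀ i, D i e = 0) → e ∈ S) (hX : ∀ i, ∀ e ∈ S, X i e ∈ S) : S = ⊤ := by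
  classical
  -- The condition `Dᵢ e = 0` is dropped for one index after the other.
  have key : ∀ s : Finset ι, ∀ e, (∀ i ∉ s, D i e = 0) → e ∈ S := by
    intro s
    induction s using Finset.induction_on with
    | empty => exact fun e he => hS e fun i => he i (Finset.notMem_empty i)
    | insert j s hj ih =>
      intro e he
      obtain ⟨k, hk⟩ := h.locNil j e
      induction k using Nat.strong_induction_on generalizing e with
      | _ k ihk =>
      rcases k with _ | k
      · rw [show e = 0 from hk]
        exact S.zero_mem
      -- `e` is the sum of its constant term, on which `Dⱼ` vanishes too, and of multiples of the
      -- `Xⱼ^m Dⱼ^m e` with `m > 0`, to which the induction on the order of nilpotency applies.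
      have hP : constTerm (D j) (X j) (h.locNil j) e ∈ S := by
        refine ih _ fun i hi => ?_
        by_cases hij : i = j
        · subst hij
          exact apply_constTerm _ (h.weyl i) _
        · rw [h.apply_constTerm_of_ne hij, he i (by simp [hij, hi]), map_zero]
      have hXk : ∀ (m : ℕ) (x : E), x ∈ S → (X j ^ m) x ∈ S := by
        intro m
        induction m with
        | zero => exact fun x hx => hx
        | succ m ihm =>
          intro x hx
          rw [pow_succ', Module.End.mul_apply]
          exact hX j _ (ihm x hx)
      rw [← sub_add_cancel e (constTerm (D j) (X j) (h.locNil j) e)]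
      refine S.add_mem (sub_constTerm_mem _ S fun m => hXk _ _ ?_) hP
      refine ihk k k.lt_succ_self _ (fun i hi => ?_) ?_
      · rw [← Module.End.mul_apply, ((h.comm_D i j).pow_right _).eq, Module.End.mul_apply, he i hi,
          map_zero]
      · rw [← Module.End.mul_apply, ← pow_add]
        exact end_pow_eq_zero_mono (by omega) hk
  exact Submodule.eq_top_iff'.2 fun e => key Finset.univ e fun i hi => absurd (Finset.mem_univ i) hi

/-- A nonzero `D`-stable submodule meets the joint kernel of the `Dᵢ`. -/
theorem eq_bot_of_stable (h : IsWeylFamily D X) (S : Submodule F E)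
    (hS : ∀ e ∈ S, (∀ i, D i e = 0) → e = 0) (hDS : ∀ i, ∀ e ∈ S, D i e ∈ S) : S = ⊥ := by
  classical
  -- As in `eq_top_of_stable`, the indices are treated one after the other.
  have key : ∀ s : Finset ι, ∀ e ∈ S, (∀ i ∉ s, D i e = 0) → e = 0 := by
    intro s
    induction s using Finset.induction_on with
    | empty => exact fun e heS he => hS e heS fun i => he i (Finset.notMem_empty i)
    | insert j s hj ih =>
      intro e heS he
      obtain ⟨k, hk⟩ := h.locNil j e
      induction k generalizing e with
      | zero => exact hk
      | succ k ihk =>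
        have h0 : D j e = 0 := ihk _ (hDS j e heS) (fun i hi => by
          rw [← Module.End.mul_apply, (h.comm_D i j).eq, Module.End.mul_apply, he i hi, map_zero])
          (by rwa [← Module.End.mul_apply, ← pow_succ])
        refine ih e heS fun i hi => ?_
        by_cases hij : i = j
        · rwa [hij]
        · exact he i (by simp [hij, hi])
  exact (Submodule.eq_bot_iff _).2 fun e he =>
    key Finset.univ e he fun i hi => absurd (Finset.mem_univ i) hi

end IsWeylFamily

end Weyl

/-! ### The centralizer of the `∂ᵢ` in `U_∂` -/

theorem toUD_mem_of_ι_mem {n : ℕ} (S : Subalgebra ℂ (UD n))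
    (h : ∀ w : Witt n, toUD n (UniversalEnvelopingAlgebra.ι ℂ w) ∈ S) (u : UW n) :
    toUD n u ∈ S := by
  let f : Witt n →ₗ⁅ℂ⁆ S :=
    { toFun := fun w => ⟨toUD n (UniversalEnvelopingAlgebra.ι ℂ w), h w⟩
      map_add' := fun a b => Subtype.ext (by simp)
      map_smul' := fun a b => Subtype.ext (by simp)
      map_lie' := fun {a b} => Subtype.ext (by
        simp only [LieHom.map_lie, LieRing.of_associative_ring_bracket, map_sub, map_mul]; rfl) }
  have hf : S.val.comp (UniversalEnvelopingAlgebra.lift ℂ f) = toUD n := by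
    apply UniversalEnvelopingAlgebra.hom_ext
    ext w
    simp [f]
  rw [← hf]
  exact (UniversalEnvelopingAlgebra.lift ℂ f u).2

/-- `U_∂` is generated by `W_n` and the `∂ᵢ⁻¹`. -/
theorem eq_top_of_generators {n : ℕ} (S : Subalgebra ℂ (UD n))
    (h : ∀ w : Witt n, toUD n (UniversalEnvelopingAlgebra.ι ℂ w) ∈ S)
    (h' : ∀ i, ((delUnit i)⁻¹.val : UD n) ∈ S) : S = ⊤ := by
  have key : ∀ s ∈ delSubmonoid n, ∀ x : UD n, toUD n s * x ∈ S → x ∈ S := by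
    intro s hs
    unfold delSubmonoid at hs
    induction hs using Submonoid.closure_induction with
    | mem y hy =>
      obtain ⟨i, rfl⟩ := hy
      intro x hx
      simpa [← coe_delUnit] using S.mul_mem (h' i) hx
    | one => exact fun x hx => by simpa using hx
    | mul y z _ _ hy hz =>
      intro x hx
      rw [map_mul, mul_assoc] at hx
      exact hz _ (hy _ hx)
  refine Algebra.eq_top_iff.2 fun x => ?_
  induction x using OreLocalization.ind with
  | _ r s =>
  refine key s s.2 _ ?_
  rw [show toUD n (s : UW n) * OreLocalization.oreDiv r s = toUD n r from
    OreLocalization.mul_cancel]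
  exact toUD_mem_of_ι_mem S h r

theorem witt_eq_sum {n : ℕ} (w : Witt n) :
    w = ∑ j, w (MvPolynomial.X j) • (MvPolynomial.pderiv j : Witt n) := by
  refine MvPolynomial.derivation_ext fun k => ?_
  have h := congrFun (map_sum Derivation.coeFnAddMonoidHom
    (fun j => w (MvPolynomial.X j) • (MvPolynomial.pderiv j : Witt n)) Finset.univ)
    (MvPolynomial.X k)
  rw [Finset.sum_apply] at h
  refine Eq.trans ?_ h.symm
  simp [Derivation.coeFnAddMonoidHom, MvPolynomial.pderiv_X, Pi.single_apply]

/-- `[hᵢ, t^α ∂ⱼ] = (αᵢ - δᵢⱼ) t^α ∂ⱼ`. -/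
theorem hasWt_monomial {n : ℕ} (i j : Fin n) (α : Fin n →₀ ℕ) (c : ℂ) :
    HasWt i ((if i = j then 1 else 0) - α i) (toUD n (UniversalEnvelopingAlgebra.ι ℂ
      ((MvPolynomial.monomial α c : MvPolynomial (Fin n) ℂ) •
        (MvPolynomial.pderiv j : Witt n)))) := by
  have h1 : MvPolynomial.X i * MvPolynomial.pderiv i (MvPolynomial.monomial α c) =
      (α i : ℂ) • (MvPolynomial.monomial α c : MvPolynomial (Fin n) ℂ) := by
    rw [MvPolynomial.X_mul_pderiv_monomial, Nat.cast_smul_eq_nsmul]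
  generalize (MvPolynomial.monomial α c : MvPolynomial (Fin n) ℂ) = p at h1 ⊢
  set w : Witt n := p • (MvPolynomial.pderiv j : Witt n) with hw
  have h : ⁅((MvPolynomial.X i : MvPolynomial (Fin n) ℂ) • (MvPolynomial.pderiv i : Witt n)), w⁆ =
        -(((if i = j then 1 else 0) - α i : ℂ) • w) := by
    refine MvPolynomial.derivation_ext fun k => ?_
    by_cases hjk : j = k
    · subst hjk
      by_cases hij : i = j
      · subst hij
        simp [hw, Derivation.commutator_apply, h1]
        module
      · simp [hw, Derivation.commutator_apply, h1, hij, MvPolynomial.pderiv_X, Ne.symm hij]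
    · by_cases hik : i = k
      · subst hik
        simp [hw, Derivation.commutator_apply, MvPolynomial.pderiv_X, Ne.symm hjk]
      · simp [hw, Derivation.commutator_apply, MvPolynomial.pderiv_X, Ne.symm hjk, Ne.symm hik]
  have h2 := LieHom.map_lie (UniversalEnvelopingAlgebra.ι ℂ)
    ((MvPolynomial.X i : MvPolynomial (Fin n) ℂ) • (MvPolynomial.pderiv i : Witt n)) w
  rw [h, map_neg, map_smul] at h2
  change _ = car i * _ - _ * car i at h2
  have h3 := congrArg (toUD n) h2
  simp only [map_neg, map_smul, map_sub, map_mul] at h3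
  unfold HasWt
  rw [sub_eq_add_neg, h3]
  abel

/-- The weight vectors of integral weight for the adjoint action of the `hᵢ` on `U_∂`. -/
def weightVectors (n : ℕ) : Submonoid (UD n) where
  carrier := {u | ∃ m : Fin n → ℤ, ∀ i, HasWt i (m i) u}
  one_mem' := ⟨0, fun i => by simpa using HasWt.one i⟩
  mul_mem' := by
    rintro a b ⟨m, hm⟩ ⟨m', hm'⟩
    exact ⟨m + m', fun i => by simpa using (hm i).mul (hm' i)⟩

/-- `U_∂` is generated by the `t^α ∂ⱼ` and the `∂ᵢ⁻¹`, which are weight vectors. -/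
theorem span_weightVectors (n : ℕ) :
    Submodule.span ℂ (weightVectors n : Set (UD n)) = ⊤ := by
  have h : Algebra.adjoin ℂ (weightVectors n : Set (UD n)) = ⊤ := by
    refine eq_top_of_generators _ (fun w => ?_) fun i => Algebra.subset_adjoin ⟨-Pi.single i 1, ?_⟩
    · rw [witt_eq_sum w, map_sum, map_sum]
      refine Subalgebra.sum_mem _ fun j _ => ?_
      induction w (MvPolynomial.X j) using MvPolynomial.induction_on' with
      | monomial α c =>
        refine Algebra.subset_adjoin ⟨fun i => (if i = j then 1 else 0) - α i, fun i => ?_⟩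
        convert hasWt_monomial i j α c using 1
        push_cast
        rfl
      | add p q hp hq =>
        rw [add_smul, map_add, map_add]
        exact Subalgebra.add_mem _ hp hq
    · intro j
      convert (hasWt_del j i).inv using 1
      by_cases hij : j = i
      · subst hij; simp
      · simp [hij]
  have := Algebra.adjoin_eq_span ℂ (weightVectors n : Set (UD n))
  rw [h, Submonoid.closure_eq] at this
  rw [← this, Algebra.top_toSubmodule]

/-- The derivation `[∂ᵢ, -]` of `U_∂`. -/
def adDel {n : ℕ} (i : Fin n) : Module.End ℂ (UD n) :=
  LinearMap.mulLeft ℂ (toUD n (del i)) - LinearMap.mulRight ℂ (toUD n (del i))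

theorem adDel_apply {n : ℕ} (i : Fin n) (u : UD n) :
    adDel i u = toUD n (del i) * u - u * toUD n (del i) := rfl

theorem adDel_pow_apply {n : ℕ} (i : Fin n) (k : ℕ) (u : UD n) :
    (adDel i ^ k) u = (adHom (toUD n (del i)))^[k] u := by
  rw [Module.End.pow_apply]; rfl

theorem adDel_locNil {n : ℕ} (i : Fin n) (u : UD n) : ∃ k, (adDel i ^ k) u = 0 := by
  let N : Subalgebra ℂ (UD n) :=
    { carrier := {u | ∃ k, (adHom (toUD n (del i)))^[k] u = 0}
      mul_mem' := fun ha hb => locNil_mul _ (adHom_mul _) ha hb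
      add_mem' := fun ha hb => locNil_add _ ha hb
      algebraMap_mem' := fun r => ⟨1, by
        simp [adHom_apply, Algebra.commutes]⟩ }
  have hN : N = ⊤ := by
    refine eq_top_of_generators N (fun w => ?_) fun j => ⟨1, ?_⟩
    · obtain ⟨k, hk⟩ := del_locNil i (UniversalEnvelopingAlgebra.ι ℂ w)
      have h : ∀ (k : ℕ) (u : UW n),
          (adHom (toUD n (del i)))^[k] (toUD n u) = toUD n ((adHom (del i))^[k] u) := by
        intro k
        induction k with
        | zero => exact fun u => rfl
        | succ k ih =>
          intro u
          rw [Function.iterate_succ_apply, Function.iterate_succ_apply, ← ih, adHom_apply,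
            adHom_apply, map_sub, map_mul, map_mul]
      exact ⟨k, by rw [h, hk, map_zero]⟩
    · have h := congrArg Units.val (delUnit_commute i j).inv_right.eq
      rw [Units.val_mul, Units.val_mul, coe_delUnit] at h
      rw [Function.iterate_one, adHom_apply, h, sub_self]
  obtain ⟨k, hk⟩ : u ∈ N := hN ▸ Algebra.mem_top
  exact ⟨k, by rw [adDel_pow_apply, hk]⟩

/-- `hⱼ ∂ⱼ⁻¹`, which serves as the coordinate conjugate to `∂ⱼ`. -/
def coord {n : ℕ} (j : Fin n) : UD n := toUD n (car j) * ((delUnit j)⁻¹.val : UD n)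

theorem del_mul_coord {n : ℕ} (i j : Fin n) :
    toUD n (del i) * coord j = coord j * toUD n (del i) + if i = j then 1 else 0 := by
  have h1 := hasWt_del j i
  unfold HasWt at h1
  rw [coe_delUnit] at h1
  have h2 := congrArg Units.val (delUnit_commute i j).inv_right.eq
  rw [Units.val_mul, Units.val_mul, coe_delUnit] at h2
  rw [coord, mul_assoc, ← h2, ← mul_assoc, ← mul_assoc, h1, sub_mul]
  by_cases hij : i = j
  · subst hij
    simp [← coe_delUnit]
  · simp [hij, Ne.symm hij]

theorem hasWt_coord {n : ℕ} (i j : Fin n) : HasWt i (-if i = j then 1 else 0) (coord j) := by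
  have h : HasWt i 0 (toUD n (car j)) := by
    simpa [HasWt] using congrArg (toUD n) (car_commute i j).eq
  simpa [coord] using h.mul (hasWt_del i j).inv

theorem isWeylFamily_adDel (n : ℕ) :
    IsWeylFamily (adDel (n := n)) fun j => LinearMap.mulLeft ℂ (coord j) where
  weyl i := by
    ext u
    simp only [Module.End.mul_apply, adDel_apply, LinearMap.mulLeft_apply, LinearMap.add_apply,
      Module.End.one_apply]
    rw [← mul_assoc, del_mul_coord, if_pos rfl]
    noncomm_ring
  comm_X i j hij := by
    ext u
    simp only [Module.End.mul_apply, adDel_apply, LinearMap.mulLeft_apply]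
    rw [← mul_assoc, del_mul_coord, if_neg hij]
    noncomm_ring
  comm_D i j := commute_commutators ((del_commute i j).map (toUD n))
  locNil := adDel_locNil

theorem HasWt.adDel_pow {n : ℕ} {j : Fin n} {c : ℂ} {u : UD n} (hu : HasWt j c u) (i : Fin n)
    (k : ℕ) : HasWt j (c + k * if j = i then 1 else 0) ((adDel i ^ k) u) := by
  induction k with
  | zero => simpa using hu
  | succ k ih =>
    rw [pow_succ', Module.End.mul_apply, adDel_apply]
    have h1 := (hasWt_del j i).mul ih
    have h2 := ih.mul (hasWt_del j i)
    rw [add_comm] at h1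
    rw [coe_delUnit] at h1 h2
    unfold HasWt at *
    rw [mul_sub, h1, h2, sub_mul, smul_sub]
    push_cast
    rw [show c + (k + 1 : ℂ) * (if j = i then 1 else 0) =
      c + k * (if j = i then 1 else 0) + if j = i then 1 else 0 by ring]
    abel

theorem HasWt.coord_pow_mul {n : ℕ} {j : Fin n} {c : ℂ} {u : UD n} (hu : HasWt j c u) (i : Fin n)
    (k : ℕ) : HasWt j (c - k * if j = i then 1 else 0)
      ((LinearMap.mulLeft ℂ (coord i) ^ k) u) := by
  induction k with
  | zero => simpa using hu
  | succ k ih =>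
    rw [pow_succ', Module.End.mul_apply, LinearMap.mulLeft_apply]
    convert (hasWt_coord j i).mul ih using 1
    push_cast
    ring

/-- Each `xᵢ^k [∂ᵢ, -]^k` preserves weights. -/
theorem hasWt_proj {n : ℕ} {c : Fin n → ℂ} {u : UD n} (hu : ∀ j, HasWt j (c j) u) (j : Fin n) :
    HasWt j (c j) ((isWeylFamily_adDel n).proj u) := by
  let S : Submodule ℂ (UD n) :=
    { carrier := {u | ∀ j, HasWt j (c j) u}
      add_mem' := fun {a b} ha hb j => by
        have h1 := ha j
        have h2 := hb j
        unfold HasWt at *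
        rw [mul_add, h1, h2, add_mul, smul_add]
        abel
      zero_mem' := fun j => by simp [HasWt]
      smul_mem' := fun r a ha j => by
        have h1 := ha j
        unfold HasWt at *
        rw [mul_smul_comm, h1, smul_mul_assoc, smul_sub, smul_comm] }
  refine (isWeylFamily_adDel n).listProj_mem S (fun i k e he j => ?_) _ hu j
  simpa using ((he j).adDel_pow i k).coord_pow_mul i k

theorem delPow_mem_K {n : ℕ} (m : Fin n → Multiplicative ℤ) : (delPow n m : UD n) ∈ Kn n := by
  have h1 : ∀ (i : Fin n) (z : ℤ), ((delUnit i ^ z : (UD n)ˣ) : UD n) ∈ Kn n := by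
    intro i z
    rcases z with z | z
    · simpa using pow_mem (delUnit_mem_K i) z
    · have : ((delUnit i)⁻¹.val : UD n) ∈ Kn n :=
        (le_sup_right : DeltaLoc n ≤ Kn n) (Algebra.subset_adjoin (Or.inr ⟨i, rfl⟩))
      simpa [zpow_negSucc, ← inv_pow] using pow_mem this (z + 1)
  have key : ∀ s : Finset (Fin n), (delPow n (∏ j ∈ s, Pi.mulSingle j (m j)) : UD n) ∈ Kn n := by
    intro s
    induction s using Finset.induction_on with
    | empty => simp [one_mem]
    | insert j s hj ih =>
      rw [Finset.prod_insert hj, map_mul, Units.val_mul, delPow_mulSingle]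
      exact mul_mem (h1 _ _) ih
  have := key Finset.univ
  rwa [Finset.univ_prod_mulSingle] at this

theorem delPow_commute_del {n : ℕ} (m : Fin n → Multiplicative ℤ) (i : Fin n) :
    Commute (delPow n m : UD n) (toUD n (del i)) := by
  have h : Commute (delPow n m) (delUnit i) := by
    have h1 := delPow_mulSingle i (Multiplicative.ofAdd 1)
    rw [toAdd_ofAdd, zpow_one] at h1
    rw [← h1]
    exact (Commute.all m _).map (delPow n)
  exact congrArg Units.val h.eq

theorem commute_del_proj {n : ℕ} (u : UD n) (i : Fin n) :
    toUD n (del i) * (isWeylFamily_adDel n).proj u =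
      (isWeylFamily_adDel n).proj u * toUD n (del i) :=
  sub_eq_zero.1 ((isWeylFamily_adDel n).apply_proj i u)

/-- A weight vector in the centralizer of the `∂ᵢ` becomes an element of `H_n` after
multiplication by a monomial in the `∂ᵢ^{±1}`. -/
theorem proj_mem_K {n : ℕ} (u : UD n) : (isWeylFamily_adDel n).proj u ∈ Kn n := by
  have hu : u ∈ Submodule.span ℂ (weightVectors n : Set (UD n)) :=
    span_weightVectors n ▸ Submodule.mem_top
  induction hu using Submodule.span_induction with
  | zero => rw [map_zero]; exact zero_mem _
  | add a b _ _ ha hb => rw [map_add]; exact add_mem ha hb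
  | smul c a _ ha => rw [map_smul]; exact Subalgebra.smul_mem _ ha c
  | mem u hu =>
    obtain ⟨m, hm⟩ := hu
    -- `y` has the weight `m` of `u`, and `∂^(-m)` has weight `-m`.
    set y := (isWeylFamily_adDel n).proj u
    let m' : Fin n → Multiplicative ℤ := fun i => Multiplicative.ofAdd (m i)
    have hy : y * (delPow n m'⁻¹ : UD n) ∈ Hn n := by
      rw [Hn, Subalgebra.mem_centralizer_iff]
      rintro _ (⟨i, rfl⟩ | ⟨i, rfl⟩)
      · have : Commute (toUD n (del i)) y := commute_del_proj u i
        exact this.mul_right (delPow_commute_del _ i).symm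
      · have := (hasWt_proj hm i).mul (delPow_wt i m'⁻¹)
        simpa [HasWt, m'] using this
    have := mul_mem (H_le_K n hy) (delPow_mem_K m')
    rwa [map_inv, Units.inv_mul_cancel_right] at this

/-- `H_n U(Δ_n)_∂` commutes with the `∂ᵢ`. -/
theorem K_commute_del {n : ℕ} {x : UD n} (hx : x ∈ Kn n) (i : Fin n) :
    Commute (toUD n (del i)) x := by
  have : Kn n ≤ Subalgebra.centralizer ℂ {toUD n (del i)} := by
    refine (K_le_range n).trans ?_
    rintro _ ⟨a, rfl⟩
    induction a using MonoidAlgebra.induction_linear with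
    | zero => rw [map_zero]; exact zero_mem _
    | add a b ha hb => rw [map_add]; exact add_mem ha hb
    | single m x =>
      change groupMap n _ ∈ _
      rw [groupMap_single, Subalgebra.mem_centralizer_iff]
      rintro _ rfl
      exact ((H_comm_del x.2 i).mul_left (delPow_commute_del m i)).symm.eq
  exact (Subalgebra.mem_centralizer_iff ℂ).1 (this hx) _ rfl

/-- The retraction of `U_∂` onto `H_n U(Δ_n)_∂` is linear for the right action of the latter. -/
theorem proj_mul {n : ℕ} (u : UD n) {x : UD n} (hx : x ∈ Kn n) :
    (isWeylFamily_adDel n).proj (u * x) = (isWeylFamily_adDel n).proj u * x := by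
  refine ((isWeylFamily_adDel n).map_proj (isWeylFamily_adDel n) (LinearMap.mulRight ℂ x)
    (fun i e => ?_) (fun i e => ?_) u).symm
  · simp only [adDel_apply, LinearMap.mulRight_apply]
    rw [sub_mul, mul_assoc, mul_assoc, mul_assoc, (K_commute_del hx i).eq]
  · simp [mul_assoc]

theorem proj_of_mem_K {n : ℕ} {x : UD n} (hx : x ∈ Kn n) :
    (isWeylFamily_adDel n).proj x = x :=
  (isWeylFamily_adDel n).proj_of_apply_eq_zero fun i =>
    sub_eq_zero.2 (K_commute_del hx i).eq

/-! ### Whittaker vectors and induced modules -/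

theorem del_sub_one_mul_coord {n : ℕ} (i j : Fin n) :
    (toUD n (del i) - 1) * coord j =
      coord j * (toUD n (del i) - 1) + if i = j then 1 else 0 := by
  rw [sub_mul, del_mul_coord, mul_sub, one_mul, mul_one]
  abel

theorem locAct_del_sub_one {n : ℕ} {M : ModuleCat.{v} (UW n)} (hM : IsLocNil n M) (i : Fin n)
    (m : M) : locAct hM (toUD n (del i) - 1) m = (del i - 1) • m := by
  rw [← locAct_toUD hM, map_sub (toUD n), map_one (toUD n)]

/-- On a locally nilpotent module, the `∂ᵢ - 1` and the `hⱼ ∂ⱼ⁻¹` form a Weyl family. -/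
theorem isWeylFamily_locAct {n : ℕ} {M : ModuleCat.{v} (UW n)} (hM : IsLocNil n M) :
    IsWeylFamily (fun i => locAct hM (toUD n (del i) - 1)) fun j => locAct hM (coord j) where
  weyl i := by
    rw [← map_mul, del_sub_one_mul_coord, if_pos rfl, map_add, map_mul, map_one]
  comm_X i j hij := by
    refine Commute.map ?_ (locAct hM)
    exact (del_sub_one_mul_coord i j).trans (by rw [if_neg hij, add_zero])
  comm_D i j := by
    have h : Commute (toUD n (del i)) (toUD n (del j)) := (del_commute i j).map (toUD n)
    exact ((h.sub_left (Commute.one_left _)).sub_right (Commute.one_right _)).map (locAct hM)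
  locNil i m := by
    obtain ⟨k, -, hk⟩ := hM m i
    have h : toUD n (del i) - 1 = toUD n (del i - 1) := by rw [map_sub, map_one]
    exact ⟨k, by rw [← map_pow, h, ← map_pow, locAct_toUD, hk]⟩

theorem mem_wh_iff {n : ℕ} {M : ModuleCat.{v} (UW n)} (hM : IsLocNil n M) {m : M} :
    m ∈ wh n M ↔ ∀ i, locAct hM (toUD n (del i) - 1) m = 0 := by
  refine forall_congr' fun i => ?_
  rw [locAct_del_sub_one, sub_smul, one_smul, sub_eq_zero]

section Induction

variable {A : Type} [Ring A] [Algebra ℂ A] (B : Subalgebra ℂ A)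

/-- The class of `a ⊗ x` in `A ⊗_B V`. -/
def indMk (V : ModuleCat.{v} B) (a : A) (x : V) : Ind B V :=
  Submodule.Quotient.mk (a ⊗ₜ[ℂ] x)

variable {B} {V : ModuleCat.{v} B}

theorem indMk_add_left (a b : A) (x : V) : indMk B V (a + b) x = indMk B V a x + indMk B V b x :=
  congrArg Submodule.Quotient.mk (TensorProduct.add_tmul a b x)

theorem indMk_add_right (a : A) (x y : V) : indMk B V a (x + y) = indMk B V a x + indMk B V a y :=
  congrArg Submodule.Quotient.mk (TensorProduct.tmul_add a x y)

theorem indMk_mul (a : A) (b : B) (x : V) : indMk B V (a * b) x = indMk B V a (b • x) :=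
  (Submodule.Quotient.eq _).2 (Submodule.subset_span ⟨a, b, x, rfl⟩)

theorem indMk_zero_left (x : V) : indMk B V 0 x = 0 :=
  congrArg Submodule.Quotient.mk (TensorProduct.zero_tmul _ x)

theorem indMk_zero_right (a : A) : indMk B V a 0 = 0 :=
  congrArg Submodule.Quotient.mk (TensorProduct.tmul_zero _ a)

theorem ind_induction {p : Ind B V → Prop} (mk : ∀ a x, p (indMk B V a x))
    (add : ∀ y z, p y → p z → p (y + z)) (z : Ind B V) : p z := by
  obtain ⟨z, rfl⟩ := Submodule.Quotient.mk_surjective _ z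
  induction z using TensorProduct.induction_on with
  | zero =>
    have := mk 0 0
    rwa [indMk_zero_left] at this
  | tmul a x => exact mk a x
  | add y z hy hz => exact add _ _ hy hz

/-- The semilinear map `A ⊗_B V → P`, `a ⊗ x ↦ σ(a) g(x)`. -/
def indLift {S P : Type*} [Ring S] [AddCommGroup P] [Module S P] (σ : A →+* S) (g : V →+ P)
    (hg : ∀ (b : B) (x : V), g (b • x) = σ b • g x) : Ind B V →ₛₗ[σ] P :=
  let f : A ⊗[ℂ] V →+ P := TensorProduct.liftAddHom
    { toFun := fun a => (DistribSMul.toAddMonoidHom P (σ a)).comp g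
      map_zero' := by ext; simp
      map_add' := fun a b => by ext; simp [add_smul] }
    (fun c a x => by
      change σ (c • a) • g x = σ a • g (c • x)
      rw [← algebraMap_smul B c x, hg, smul_smul, ← map_mul, Subalgebra.coe_algebraMap,
        ← Algebra.commutes, Algebra.smul_def])
  (balanced B V).liftQ
    { f with
      map_smul' := fun a z => by
        change f (a • z) = σ a • f z
        induction z using TensorProduct.induction_on with
        | zero => rw [smul_zero, map_zero, smul_zero]
        | tmul b x =>
          change σ (a * b) • g x = σ a • σ b • g x
          rw [map_mul, mul_smul]
        | add y z hy hz => rw [smul_add, map_add, hy, hz, map_add, smul_add] }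
    (by
      refine Submodule.span_le.2 ?_
      rintro _ ⟨a, b, x, rfl⟩
      rw [SetLike.mem_coe, LinearMap.mem_ker, map_sub, sub_eq_zero]
      change σ (a * b) • g x = σ a • g (b • x)
      rw [hg, map_mul, mul_smul])

theorem indLift_indMk {S P : Type*} [Ring S] [AddCommGroup P] [Module S P] (σ : A →+* S)
    (g : V →+ P) (hg : ∀ (b : B) (x : V), g (b • x) = σ b • g x) (a : A) (x : V) :
    indLift σ g hg (indMk B V a x) = σ a • g x := rfl

/-- If `B` is a direct summand of `A` as a right `B`-module, with
retraction `ρ`, then `V → A ⊗_B V` is injective. -/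
theorem indMk_one_injective (ρ : A →ₗ[ℂ] B) (hρ : ∀ a (b : B), ρ (a * b) = ρ a * b)
    (h1 : ρ 1 = 1) : Function.Injective (indMk B V 1) := by
  intro x y hxy
  -- `a ⊗ x ↦ ρ(a) x` inverts `x ↦ 1 ⊗ x` on the left.
  let r : A ⊗[ℂ] V →ₗ[ℂ] V := TensorProduct.lift
    (LinearMap.mk₂ ℂ (fun a x => ρ a • x) (fun a b x => by rw [map_add, add_smul])
      (fun c a x => by rw [map_smul, smul_assoc]) (fun a x y => smul_add _ _ _)
      (fun c a x => smul_comm _ _ _))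
  have hr : ∀ z ∈ balanced B V, ∀ a : A, r (a • z) = 0 := by
    intro z hz
    induction hz using Submodule.span_induction with
    | mem z hz =>
      obtain ⟨a, b, x, rfl⟩ := hz
      intro c
      rw [smul_sub, map_sub, TensorProduct.smul_tmul', TensorProduct.smul_tmul', sub_eq_zero]
      change ρ (c * (a * b)) • x = ρ (c * a) • b • x
      rw [← mul_assoc, hρ, mul_smul]
    | zero => simp
    | add y z _ _ hy hz => intro a; rw [smul_add, map_add, hy, hz, add_zero]
    | smul b z _ hz => intro a; rw [← mul_smul, hz]
  have h := hr _ ((Submodule.Quotient.eq _).1 hxy) 1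
  rw [one_smul, map_sub, sub_eq_zero] at h
  change ρ 1 • x = ρ 1 • y at h
  simpa [h1] using h

end Induction

/-- The `H_n U(Δ_n)_∂`-module obtained from an `H_n`-module by `∂ᵢ v = v`. -/
abbrev inflate {n : ℕ} (V : FinHMod.{v} n) : ModuleCat.{v} (Kn n) :=
  (ModuleCat.restrictScalars (eps n).toRingHom).obj V.obj

/-- The class of `a ⊗ x` in `U_∂ ⊗ V`, as an element of the `W_n`-module. -/
def indTmul {n : ℕ} (V : FinHMod.{v} n) (a : UD n) (x : V.obj) : (inductionFunctor n).obj V :=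
  indMk (Kn n) (inflate V) a x

theorem indTmul_mul {n : ℕ} (V : FinHMod.{v} n) (a : UD n) (k : Kn n) (x : V.obj) :
    indTmul V (a * k) x = indTmul V a (eps n k • x) :=
  indMk_mul (V := inflate V) a k x

theorem indTmul_mul_del {n : ℕ} (V : FinHMod.{v} n) (a : UD n) (i : Fin n) (x : V.obj) :
    indTmul V (a * toUD n (del i)) x = indTmul V a x := by
  have := indTmul_mul V a ⟨delUnit i, delUnit_mem_K i⟩ x
  rwa [eps_del, one_smul] at this

theorem smul_indTmul {n : ℕ} (V : FinHMod.{v} n) (u : UW n) (a : UD n) (x : V.obj) :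
    u • indTmul V a x = indTmul V (toUD n u * a) x := rfl

theorem induction_induction {n : ℕ} {V : FinHMod.{v} n}
    {p : (inductionFunctor n).obj V → Prop} (mk : ∀ a x, p (indTmul V a x))
    (add : ∀ y z, p y → p z → p (y + z)) (z : (inductionFunctor n).obj V) : p z :=
  ind_induction (B := Kn n) (V := inflate V) mk add z

/-- `a ↦ a ⊗ x`. -/
def indTmulLeft {n : ℕ} (V : FinHMod.{v} n) (x : V.obj) :
    UD n →ₗ[ℂ] (inductionFunctor n).obj V where
  toFun a := indTmul V a x
  map_add' a b := indMk_add_left (V := inflate V) a b x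
  map_smul' c a := by
    rw [RingHom.id_apply, ← algebraMap_smul (UW n) c (indTmul V a x), smul_indTmul,
      AlgHom.commutes, Algebra.smul_def]

theorem indTmulLeft_apply {n : ℕ} (V : FinHMod.{v} n) (x : V.obj) (a : UD n) :
    indTmulLeft V x a = indTmul V a x := rfl

theorem del_sub_one_smul_indTmul {n : ℕ} (V : FinHMod.{v} n) (i : Fin n) (a : UD n)
    (x : V.obj) : (del i - 1) • indTmul V a x = indTmul V (adDel i a) x := by
  rw [sub_smul, one_smul, smul_indTmul, adDel_apply, ← indTmulLeft_apply V x (_ - _), map_sub,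
    indTmulLeft_apply, indTmulLeft_apply, indTmul_mul_del]

theorem isLocNil_induction {n : ℕ} (V : FinHMod.{v} n) :
    IsLocNil n ((inductionFunctor n).obj V) := by
  intro m i
  induction m using induction_induction with
  | mk a x =>
    have h : ∀ (k : ℕ) (a : UD n),
        (del i - 1) ^ k • indTmul V a x = indTmul V ((adDel i ^ k) a) x := by
      intro k
      induction k with
      | zero => intro a; rw [pow_zero, one_smul]; rfl
      | succ k ih =>
        intro a
        rw [pow_succ, mul_smul, del_sub_one_smul_indTmul, ih, pow_succ, Module.End.mul_apply]
    obtain ⟨k, hk⟩ := adDel_locNil i a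
    refine ⟨k + 1, k.succ_pos, ?_⟩
    rw [h, end_pow_eq_zero_mono k.le_succ hk]
    exact map_zero (indTmulLeft V x)
  | add y z hy hz =>
    obtain ⟨k, hk0, hk⟩ := hy
    obtain ⟨l, -, hl⟩ := hz
    refine ⟨k + l, by omega, ?_⟩
    rw [smul_add, pow_add, mul_smul, mul_smul, hl, smul_zero, add_zero, smul_smul,
      ((Commute.refl (del i - 1)).pow_pow k l).eq, mul_smul, hk, smul_zero]

/-- The action of `U_∂` on `U_∂ ⊗ V` obtained by extending that of `W_n` is the original one. -/
theorem locAct_indTmul {n : ℕ} {V : FinHMod.{v} n} (h : IsLocNil n ((inductionFunctor n).obj V))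
    (u a : UD n) (x : V.obj) : locAct h u (indTmul V a x) = indTmul V (u * a) x := by
  induction u using OreLocalization.ind with
  | _ r s =>
  have hs : toUD n (s : UW n) * OreLocalization.oreDiv r s = toUD n r :=
    OreLocalization.mul_cancel
  apply ((Module.End.isUnit_iff _).1 (isUnit_delSubmonoid h s)).1
  rw [act_apply, act_apply, ← locAct_toUD h, ← Module.End.mul_apply, ← map_mul, hs, locAct_toUD,
    smul_indTmul, smul_indTmul, ← mul_assoc, hs]

/-- The projection onto the Whittaker vectors of `U_∂ ⊗ V` is induced by the one of `U_∂` onto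
`H_n U(Δ_n)_∂`. -/
theorem proj_indTmul {n : ℕ} {V : FinHMod.{v} n} (h : IsLocNil n ((inductionFunctor n).obj V))
    (a : UD n) (x : V.obj) : (isWeylFamily_locAct h).proj (indTmul V a x) =
      indTmul V ((isWeylFamily_adDel n).proj a) x := by
  refine ((isWeylFamily_adDel n).map_proj (isWeylFamily_locAct h) (indTmulLeft V x)
    (fun i a => ?_) (fun i a => ?_) a).symm
  · rw [locAct_del_sub_one]
    exact (del_sub_one_smul_indTmul V i a x).symm
  · exact (locAct_indTmul h _ a x).symm

theorem indTmul_one_mem_wh {n : ℕ} (V : FinHMod.{v} n) (x : V.obj) :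
    indTmul V 1 x ∈ wh n ((inductionFunctor n).obj V) := by
  intro i
  rw [smul_indTmul, mul_one, ← one_mul (toUD n (del i)), indTmul_mul_del]

/-- A Whittaker vector is fixed by the projection, whose image is `1 ⊗ V`. -/
theorem exists_of_mem_wh {n : ℕ} {V : FinHMod.{v} n} {m : (inductionFunctor n).obj V}
    (hm : m ∈ wh n ((inductionFunctor n).obj V)) : ∃ x, indTmul V 1 x = m := by
  have h := isLocNil_induction V
  rw [← (isWeylFamily_locAct h).proj_of_apply_eq_zero ((mem_wh_iff h).1 hm)]
  clear hm
  induction m using induction_induction with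
  | mk a x =>
    refine ⟨eps n ⟨_, proj_mem_K a⟩ • x, ?_⟩
    rw [proj_indTmul, ← indTmul_mul, one_mul]
  | add y z hy hz =>
    obtain ⟨y', hy⟩ := hy
    obtain ⟨z', hz⟩ := hz
    exact ⟨y' + z', by
      rw [map_add, ← hy, ← hz]
      exact indMk_add_right (V := inflate V) 1 y' z'⟩

theorem indTmul_one_injective {n : ℕ} (V : FinHMod.{v} n) : Function.Injective (indTmul V 1) :=
  indMk_one_injective (V := inflate V)
    (LinearMap.codRestrict (Subalgebra.toSubmodule (Kn n)) (isWeylFamily_adDel n).proj proj_mem_K)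
    (fun a b => Subtype.ext (proj_mul a b.2)) (Subtype.ext (proj_of_mem_K (one_mem _)))

theorem isWhittaker_induction {n : ℕ} (V : FinHMod.{v} n) :
    IsWhittaker n ((inductionFunctor n).obj V) := by
  refine ⟨isLocNil_induction V, ?_⟩
  have : Module.Finite ℂ V.obj := V.property
  refine Module.Finite.of_surjective
    ({ toFun := fun x => ⟨indTmul V 1 x, indTmul_one_mem_wh V x⟩
       map_add' := fun x y => Subtype.ext (indMk_add_right (V := inflate V) 1 x y)
       map_smul' := fun c x => Subtype.ext ?_ } : V.obj →ₗ[ℂ] wh n ((inductionFunctor n).obj V))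
    fun m => ?_
  · have h := indTmul_mul V 1 (algebraMap ℂ (Kn n) c) x
    rw [AlgHom.commutes, algebraMap_smul] at h
    refine h.symm.trans ?_
    rw [one_mul, RingHom.id_apply, Subalgebra.coe_algebraMap, Algebra.algebraMap_eq_smul_one]
    exact map_smul (indTmulLeft V x) c 1
  · obtain ⟨x, hx⟩ := exists_of_mem_wh m.2
    exact ⟨x, Subtype.ext hx⟩

variable (n : ℕ)

/-- The functor `V ↦ U_∂ ⊗ V` with values in `Ω_𝟏`. -/
abbrev inductionOmega : FinHMod.{v} n ⥤ Omega.{v} n :=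
  (IsWhittaker.{v} n).lift (inductionFunctor n) isWhittaker_induction

variable {n}

/-- The map `V → wh_𝟏(U_∂ ⊗ V)`, `x ↦ 1 ⊗ x`. -/
def whUnit (V : FinHMod.{v} n) : V ⟶ (whFunctor n).obj ((inductionOmega n).obj V) :=
  ObjectProperty.homMk (ModuleCat.ofHom (Y := wh n ((inductionOmega n).obj V).obj)
    { toFun := fun x => (⟨indTmul V 1 x, indTmul_one_mem_wh V x⟩ :
        wh n ((inductionOmega n).obj V).obj)
      map_add' := fun x y => Subtype.ext (indMk_add_right (V := inflate V) 1 x y)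
      map_smul' := fun u x => Subtype.ext (by
        change _ = locAct (isLocNil_induction V) (u : UD n) (indTmul V 1 x)
        rw [locAct_indTmul, mul_one, ← one_mul (u : UD n)]
        have := indTmul_mul V 1 ⟨u, H_le_K n u.2⟩ x
        rw [eps_of_mem_H] at this
        exact this.symm) })

theorem whUnit_bijective (V : FinHMod.{v} n) : Function.Bijective (whUnit V).hom.hom := by
  constructor
  · intro x y hxy
    exact indTmul_one_injective V (congrArg Subtype.val hxy)
  · intro m
    obtain ⟨x, hx⟩ := exists_of_mem_wh m.2
    exact ⟨x, Subtype.ext hx⟩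

/-- The monomials in the `∂ᵢ^{±1}` fix the Whittaker vectors. -/
theorem locAct_delPow {M : ModuleCat.{v} (UW n)} (hM : IsLocNil n M) {m : M} (hm : m ∈ wh n M)
    (p : Fin n → Multiplicative ℤ) : locAct hM (delPow n p : UD n) m = m := by
  let S : Subgroup (UD n)ˣ :=
    { carrier := {g | locAct hM (g : UD n) m = m}
      one_mem' := by simp
      mul_mem' := fun {a b} (ha : _ = _) (hb : _ = _) => by
        rw [Set.mem_ofPred_eq, Units.val_mul, map_mul, Module.End.mul_apply, hb, ha]
      inv_mem' := fun {a} (ha : _ = _) => by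
        rw [Set.mem_ofPred_eq]
        nth_rw 1 [← ha]
        rw [← Module.End.mul_apply, ← map_mul, Units.inv_mul, map_one, Module.End.one_apply] }
  have key : ∀ s : Finset (Fin n), delPow n (∏ j ∈ s, Pi.mulSingle j (p j)) ∈ S := by
    intro s
    induction s using Finset.induction_on with
    | empty => rw [Finset.prod_empty, map_one]; exact one_mem S
    | insert j s hj ih =>
      rw [Finset.prod_insert hj, map_mul, delPow_mulSingle]
      refine mul_mem (zpow_mem ?_ _) ih
      change locAct hM (delUnit j : UD n) m = m
      rw [coe_delUnit, locAct_toUD, hm j]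
  have := key Finset.univ
  rwa [Finset.univ_prod_mulSingle] at this

/-- `H_n U(Δ_n)_∂` acts on the Whittaker vectors through its projection onto `H_n`. -/
theorem locAct_eps {M : ModuleCat.{v} (UW n)} (hM : IsLocNil n M) {m : M} (hm : m ∈ wh n M)
    (k : Kn n) : locAct hM (eps n k) m = locAct hM k m := by
  obtain ⟨a, ha⟩ := K_le_range n k.2
  change groupMap n a = k at ha
  rw [eps_groupMap k a ha, ← ha]
  clear ha
  induction a using MonoidAlgebra.induction_linear with
  | zero => simp
  | add a b ha hb => simp only [map_add, Subalgebra.coe_add, LinearMap.add_apply, ha, hb]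
  | single p x =>
    rw [augment_single, groupMap_single, map_mul, Module.End.mul_apply, locAct_delPow hM hm]

/-- The map `U_∂ ⊗ wh_𝟏(M) → M`, `a ⊗ m ↦ a m`. -/
def evalSemilinear (M : Omega.{v} n) :
    Ind (Kn n) (inflate ((whFunctor n).obj M)) →ₛₗ[locAct M.property.1] M.obj :=
  indLift (V := inflate ((whFunctor n).obj M)) (locAct M.property.1)
    { toFun := fun m : wh n M.obj => (m : M.obj)
      map_zero' := rfl
      map_add' := fun _ _ => rfl }
    fun k m => locAct_eps M.property.1 (m : wh n M.obj).2 k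

/-- The map `U_∂ ⊗ wh_𝟏(M) → M`, `a ⊗ m ↦ a m`, in `Ω_𝟏`. -/
def whCounit (M : Omega.{v} n) : (inductionOmega n).obj ((whFunctor n).obj M) ⟶ M :=
  ObjectProperty.homMk (ModuleCat.ofHom (X := (inductionFunctor n).obj ((whFunctor n).obj M))
    (Y := M.obj)
    { toFun := evalSemilinear M
      map_add' := map_add _
      map_smul' := fun u z =>
        ((evalSemilinear M).map_smulₛₗ (toUD n u) z).trans (locAct_toUD _ u _) })

theorem whCounit_indTmul (M : Omega.{v} n) (a : UD n) (m : wh n M.obj) :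
    (whCounit M).hom.hom (indTmul ((whFunctor n).obj M) a m) = locAct M.property.1 a (m : M.obj) :=
  indLift_indMk (V := inflate ((whFunctor n).obj M)) (locAct M.property.1)
    { toFun := fun m : wh n M.obj => (m : M.obj)
      map_zero' := rfl
      map_add' := fun _ _ => rfl }
    (fun k m => locAct_eps M.property.1 (m : wh n M.obj).2 k) a m

theorem whCounit_bijective (M : Omega.{v} n) : Function.Bijective (whCounit M).hom.hom := by
  let V := (whFunctor n).obj M
  let f : (inductionFunctor n).obj V →ₗ[UW n] M.obj := (whCounit M).hom.hom
  let g : (inductionFunctor n).obj V →ₗ[ℂ] M.obj := f.restrictScalars ℂ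
  have hV := isLocNil_induction V
  have hg : ∀ a z, g (locAct hV a z) = locAct M.property.1 a (g z) := by
    exact fun a z => locAct_map hV M.property.1 (whCounit M).hom a z
  change Function.Bijective g
  constructor
  -- A Whittaker vector of the kernel has the form `1 ⊗ x`, which is sent to `x`.
  · rw [← LinearMap.ker_eq_bot]
    refine (isWeylFamily_locAct hV).eq_bot_of_stable _ (fun e he h0 => ?_) fun i e he => ?_
    · obtain ⟨x, rfl⟩ := exists_of_mem_wh ((mem_wh_iff hV).2 h0)
      have h1 : (x : wh n M.obj).1 = 0 := by
        have h2 : locAct M.property.1 1 (x : wh n M.obj).1 = 0 :=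
          (whCounit_indTmul M 1 x).symm.trans he
        rwa [map_one] at h2
      rw [show x = 0 from Subtype.ext h1]
      exact indMk_zero_right (V := inflate V) 1
    · rw [LinearMap.mem_ker] at he ⊢
      rw [hg, he, map_zero]
  -- The range contains `wh_𝟏(M)` and is stable under `U_∂`.
  · rw [← LinearMap.range_eq_top]
    refine (isWeylFamily_locAct M.property.1).eq_top_of_stable _ (fun e he => ?_) fun i e he => ?_
    · refine ⟨indTmul V 1 (⟨e, (mem_wh_iff M.property.1).2 he⟩ : wh n M.obj), ?_⟩
      refine (whCounit_indTmul M 1 _).trans ?_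
      rw [map_one]
      rfl
    · obtain ⟨z, rfl⟩ := he
      exact ⟨_, hg _ z⟩

instance isIso_whUnit (V : FinHMod.{v} n) : IsIso (whUnit V) := by
  have : IsIso ((IsFinDim.{v} n).ι.map (whUnit V)) :=
    (ConcreteCategory.isIso_iff_bijective _).2 (whUnit_bijective V)
  exact isIso_of_reflects_iso (whUnit V) (IsFinDim.{v} n).ι

instance isIso_whCounit (M : Omega.{v} n) : IsIso (whCounit M) := by
  have : IsIso ((IsWhittaker.{v} n).ι.map (whCounit M)) :=
    (ConcreteCategory.isIso_iff_bijective _).2 (whCounit_bijective M)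
  exact isIso_of_reflects_iso (whCounit M) (IsWhittaker.{v} n).ι

variable (n)

/-- `V ≅ wh_𝟏(U_∂ ⊗ V)`, naturally in `V`. -/
def whUnitIso : 𝟭 (FinHMod.{v} n) ≅ inductionOmega n ⋙ whFunctor n :=
  NatIso.ofComponents (fun V => asIso (X := V) (Y := (whFunctor n).obj ((inductionOmega n).obj V))
    (whUnit V)) fun _ => rfl

/-- `U_∂ ⊗ wh_𝟏(M) ≅ M`, naturally in `M`. -/
def whCounitIso : whFunctor.{v} n ⋙ inductionOmega n ≅ 𝟭 (Omega.{v} n) :=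
  NatIso.ofComponents (fun M => asIso (X := (inductionOmega n).obj ((whFunctor n).obj M)) (Y := M)
    (whCounit M)) fun {M N} f => by
    ext z
    change (whCounit N).hom.hom (((inductionFunctor n).map ((whFunctor n).map f)).hom z) =
      f.hom.hom ((whCounit M).hom.hom z)
    induction z using induction_induction with
    | mk a m => exact (locAct_map M.property.1 N.property.1 f.hom a (m : wh n M.obj).1).symm
    | add y z hy hz => simp only [map_add, hy, hz]

end WittWhittaker
end

theorem proposition4p2 (n : ℕ) (hn : 0 < n) :
    ∃ hG : ∀ V : WittWhittaker.FinHMod.{v} n,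
        WittWhittaker.IsWhittaker n ((WittWhittaker.inductionFunctor n).obj V),
      ∃ e : WittWhittaker.Omega.{v} n ≌ WittWhittaker.FinHMod.{v} n,
        e.functor = WittWhittaker.whFunctor n ∧
        e.inverse =
          (WittWhittaker.IsWhittaker n).lift (WittWhittaker.inductionFunctor n) hG :=
  ⟨WittWhittaker.isWhittaker_induction,
    CategoryTheory.Equivalence.mk (WittWhittaker.whFunctor n) (WittWhittaker.inductionOmega n)
      (WittWhittaker.whCounitIso n).symm (WittWhittaker.whUnitIso n).symm, rfl, rfl⟩
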